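/- Let $n\ge 1$, $Q=[0,1]\times[0,1]$, and let $f^1,f^2:Q\times\mathbb R^n\to\mathbb R^n$ and $A^1,A^2:Q\to\mathbb R^{n\times n}$ satisfy: (C1) for every $z\in\mathbb R^n$ the functions $f^1(\cdot,\cdot,z)$, $f^2(\cdot,\cdot,z)$ are measurable on $Q$; for a.e. $(x,y)\in Q$ the functions $f^1(x,y,\cdot)$, $f^2(x,y,\cdot)$ are continuously differentiable on $\mathbb R^n$; $A^1(\cdot,y)$ is differentiable on $[0,1]$ for a.e. $y\in[0,1]$ and $A^2(x,\cdot)$ is differentiable on $[0,1]$ for a.e. $x\in[0,1]$; the functions $A^1,A^2,A^1_x,A^2_y$ are measurable and essentially bounded on $Q$. (C2) there are a constant $B>0$ and a nonnegative function $b\in L^2(Q,\mathbb R)$ such that for a.e. $(x,y)\in Q$ and all $z\in\mathbb R^n$ $$|f^1(x,y,z)|,\ |f^2(x,y,z)|\le B|z|+b(x,y),\qquad |A^1(x,y)|,\ |A^2(x,y)|,\ |A^1_x(x,y)|,\ |A^2_y(x,y)|\le B.$$ (C3) for every $\varrho>0$ there is a constant $M_\varrho$ such that $|f^1_z(x,y,z)|,\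 |f^2_z(x,y,z)|\le M_\varrho$ for a.e. $(x,y)\in Q$ and all $|z|\le\varrho$. A function $z:Q\to\mathbb R^n$ is called absolutely continuous on $Q$ if there are $l\in L^1(Q,\mathbb R^n)$, $l^1,l^2\in L^1([0,1],\mathbb R^n)$ and $c\in\mathbb R^n$ with $$z(x,y)=\int_0^x\!\!\int_0^y l(s,t)\,ds\,dt+\int_0^x l^1(s)\,ds+\int_0^y l^2(t)\,dt+c\qquad\text{for all }(x,y)\in Q;$$ such a function has partial derivatives $z_x,z_y,z_{xy}$ a.e. on $Q$. Let $AC_0^2=AC_0^2(Q,\mathbb R^n)$ be the space of the absolutely continuous functions $z$ on $Q$ with $z(x,0)=0$ for $x\in[0,1]$, $z(0,y)=0$ for $y\in[0,1]$ and $z_{xy}\in L^2(Q,\mathbb R^n)$, with the norm $\|z\|=\|z_{xy}\|_{L^2}$. Then for every $v\in L^2(Q,\mathbb R^n)$ there is a unique $z_v\in AC_0^2$ such that $z=z_v$ satisfies $$z_{xy}(x,y)+f^1(x,y,z(x,y))+\int_0^x\!\!\int_0^y\bigl(f^2(s,t,z(s,t))+A^1(s,t)z_x(s,t)+A^2(s,t)z_y(s,t)\bigr)\,ds\,dt=v(x,y)$$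 for a.e. $(x,y)\in Q$. The solution $z_v$ depends continuously on $v$ with respect to the norm topologies of $L^2(Q,\mathbb R^n)$ and $AC_0^2$, and the operator $L^2(Q,\mathbb R^n)\ni v\mapsto z_v\in AC_0^2$ is Fréchet differentiable at every point. -/

import Mathlib

open MeasureTheory Set Filter Topology
open scoped ENNReal

namespace TwoDSystem

/-! ### The square, rectangles, partial derivatives, absolute continuity -/

/-- The unit square `Q = [0,1] × [0,1]`. -/
def unitSq : Set (ℝ × ℝ) := Icc 0 1 ×ˢ Icc 0 1

/-- The rectangle `[0,x] × [0,y]`, for `p = (x,y)`. -/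
def rect (p : ℝ × ℝ) : Set (ℝ × ℝ) := Icc 0 p.1 ×ˢ Icc 0 p.2

/-- The partial derivative `g_x` on the square (one-sided at its sides). -/
noncomputable def pdx {F : Type*} [NormedAddCommGroup F] [NormedSpace ℝ F] (g : ℝ × ℝ → F)
    (p : ℝ × ℝ) : F := derivWithin (fun s => g (s, p.2)) (Icc 0 1) p.1

/-- The partial derivative `g_y` on the square (one-sided at its sides). -/
noncomputable def pdy {F : Type*} [NormedAddCommGroup F] [NormedSpace ℝ F] (g : ℝ × ℝ → F)
    (p : ℝ × ℝ) : F := derivWithin (fun t => g (p.1, t)) (Icc 0 1) p.2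

/-- Absolute continuity on the square:
`z(x,y) = ∫₀ˣ∫₀ʸ l + ∫₀ˣ l₁ + ∫₀ʸ l₂ + c` with integrable `l`, `l₁`, `l₂` and a constant `c`. -/
def AbsContSq {F : Type*} [NormedAddCommGroup F] [NormedSpace ℝ F] (z : ℝ × ℝ → F) : Prop :=
  ∃ (l : ℝ × ℝ → F) (l₁ l₂ : ℝ → F) (c : F),
    IntegrableOn l unitSq ∧ IntegrableOn l₁ (Icc 0 1) ∧ IntegrableOn l₂ (Icc 0 1) ∧
    ∀ p ∈ unitSq, z p = (∫ q in rect p, l q) + (∫ s in Icc 0 p.1, l₁ s) +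
      (∫ t in Icc 0 p.2, l₂ t) + c

/-! ### Almost everywhere differentiability of double integrals -/

theorem integrable_integral_Iic {F : Type*} [NormedAddCommGroup F] [NormedSpace ℝ F] {k : ℝ × ℝ → F}
    (hk : Integrable k) (y : ℝ) : Integrable (fun u => ∫ t in Iic y, k (u, t)) := by
  have h : Integrable k ((volume : Measure ℝ).prod (volume.restrict (Iic y))) := by
    have := hk.integrableOn (s := univ ×ˢ Iic y)
    rwa [IntegrableOn, Measure.volume_eq_prod, ← Measure.prod_restrict,
      Measure.restrict_univ] at this
  exact h.integral_prod_left

theorem ae_forall_hasDerivAt_integral_fst {E : Type*} [NormedAddCommGroup E] [NormedSpace ℝ E] [CompleteSpace E]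
    {l : ℝ × ℝ → E} (hl : Integrable l) :
    ∀ᵐ x, ∀ y, HasDerivAt (fun s => ∫ u in (0 : ℝ)..s, ∫ t in Iic y, l (u, t))
      (∫ t in Iic y, l (x, t)) x := by
  have H1 : ∀ᵐ x, Integrable (fun t => l (x, t)) := by
    rw [Measure.volume_eq_prod] at hl
    exact hl.prod_right_ae
  have H2 : ∀ᵐ x, ∀ q : ℚ, ∀ c, HasDerivAt (fun s => ∫ u in c..s, ∫ t in Iic (q : ℝ), l (u, t))
      (∫ t in Iic (q : ℝ), l (x, t)) x := by
    rw [ae_all_iff]; intro q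
    filter_upwards [LocallyIntegrable.ae_hasDerivAt_integral
      (integrable_integral_Iic hl q).locallyIntegrable] with x hx c using hx c
  have H3 : ∀ᵐ x, ∀ q : ℚ, ∀ c,
      HasDerivAt (fun s => ∫ u in c..s, ∫ t in Iic (q : ℝ), ‖l (u, t)‖)
      (∫ t in Iic (q : ℝ), ‖l (x, t)‖) x := by
    rw [ae_all_iff]; intro q
    filter_upwards [LocallyIntegrable.ae_hasDerivAt_integral
      (integrable_integral_Iic hl.norm q).locallyIntegrable] with x hx c using hx c
  filter_upwards [H1, H2, H3] with x h1 h2 h3 y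
  have bd : ∀ u, Integrable (fun t => l (u, t)) → ∀ q q' : ℝ, q < y → y < q' →
      ‖(∫ t in Iic y, l (u, t)) - ∫ t in Iic q, l (u, t)‖ ≤
        (∫ t in Iic q', ‖l (u, t)‖) - ∫ t in Iic q, ‖l (u, t)‖ := by
    intro u hu q q' hq hq'
    rw [intervalIntegral.integral_Iic_sub_Iic hu.integrableOn hu.integrableOn,
      intervalIntegral.integral_Iic_sub_Iic hu.norm.integrableOn hu.norm.integrableOn]
    refine (intervalIntegral.norm_integral_le_integral_norm hq.le).trans ?_
    refine intervalIntegral.integral_mono_interval le_rfl hq.le hq'.le ?_ hu.norm.intervalIntegrable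
    exact Eventually.of_forall fun _ => norm_nonneg _
  rw [hasDerivAt_iff_isLittleO, Asymptotics.isLittleO_iff]
  intro c hc
  obtain ⟨q, q', hq, hq', hδ⟩ : ∃ q q' : ℚ, (q : ℝ) < y ∧ y < q' ∧
      (∫ t in Iic (q' : ℝ), ‖l (x, t)‖) - ∫ t in Iic (q : ℝ), ‖l (x, t)‖ < c / 4 := by
    have hcont : Continuous fun b => ∫ t in y..b, ‖l (x, t)‖ :=
      intervalIntegral.continuous_primitive (fun a b => h1.norm.intervalIntegrable) y
    have h0 : Tendsto (fun b => ∫ t in y..b, ‖l (x, t)‖) (𝓝 y) (𝓝 0) := by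
      simpa using hcont.tendsto y
    obtain ⟨δ, hδ, hb⟩ := Metric.tendsto_nhds_nhds.1 h0 (c / 8) (by linarith)
    obtain ⟨q, hq1, hq2⟩ := exists_rat_btwn (show y - δ < y by linarith)
    obtain ⟨q', hq1', hq2'⟩ := exists_rat_btwn (show y < y + δ by linarith)
    refine ⟨q, q', hq2, hq1', ?_⟩
    have e1 := hb (x := (q : ℝ)) (by rw [Real.dist_eq, abs_lt]; constructor <;> linarith)
    have e2 := hb (x := (q' : ℝ)) (by rw [Real.dist_eq, abs_lt]; constructor <;> linarith)
    rw [intervalIntegral.integral_Iic_sub_Iic h1.norm.integrableOn h1.norm.integrableOn,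
      ← intervalIntegral.integral_interval_sub_left (a := y) h1.norm.intervalIntegrable
        h1.norm.intervalIntegrable]
    rw [Real.dist_eq, sub_zero] at e1 e2
    have := (abs_lt.1 e1).1
    have := (abs_lt.1 e2).2
    linarith
  have E1 := (Asymptotics.isLittleO_iff.1 (hasDerivAt_iff_isLittleO.1 (h2 q 0)))
    (show 0 < c / 4 by linarith)
  have E2 := (Asymptotics.isLittleO_iff.1 (hasDerivAt_iff_isLittleO.1 ((h3 q' 0).sub (h3 q 0))))
    (show 0 < c / 4 by linarith)
  filter_upwards [E1, E2] with s e1 e2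
  have ii : ∀ y a b, IntervalIntegrable (fun u => ∫ t in Iic y, l (u, t)) volume a b :=
    fun y a b => (integrable_integral_Iic hl y).intervalIntegrable
  have jj : ∀ y a b, IntervalIntegrable (fun u => ∫ t in Iic y, ‖l (u, t)‖) volume a b :=
    fun y a b => (integrable_integral_Iic hl.norm y).intervalIntegrable
  have hb := bd x h1 q q' hq hq'
  set D := (∫ t in Iic (q' : ℝ), ‖l (x, t)‖) - ∫ t in Iic (q : ℝ), ‖l (x, t)‖ with hD
  have m : ‖∫ u in x..s, ((∫ t in Iic y, l (u, t)) - ∫ t in Iic (q : ℝ), l (u, t))‖ ≤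
      |∫ u in x..s, ((∫ t in Iic (q' : ℝ), ‖l (u, t)‖) - ∫ t in Iic (q : ℝ), ‖l (u, t)‖)| := by
    refine intervalIntegral.norm_integral_le_abs_of_norm_le ?_ ((jj _ _ _).sub (jj _ _ _))
    refine ae_restrict_of_ae ?_
    filter_upwards [H1] with u hu using bd u hu q q' hq hq'
  rw [intervalIntegral.integral_sub (ii _ _ _) (ii _ _ _),
    intervalIntegral.integral_sub (jj _ _ _) (jj _ _ _)] at m
  rw [intervalIntegral.integral_interval_sub_left (ii _ _ _) (ii _ _ _)] at e1 ⊢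
  have e2' : |((∫ u in x..s, ∫ t in Iic (q' : ℝ), ‖l (u, t)‖) -
      ∫ u in x..s, ∫ t in Iic (q : ℝ), ‖l (u, t)‖) - (s - x) * D| ≤ c / 4 * ‖s - x‖ := by
    rw [← intervalIntegral.integral_interval_sub_left (a := 0) (jj q' _ _) (jj q' _ _),
      ← intervalIntegral.integral_interval_sub_left (a := 0) (jj q _ _) (jj q _ _)]
    rw [Real.norm_eq_abs] at e2
    convert e2 using 2
    simp only [Pi.sub_apply, smul_eq_mul]
    ring
  have e3 : |(s - x) * D| ≤ c / 4 * ‖s - x‖ := by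
    rw [abs_mul, mul_comm, ← Real.norm_eq_abs (s - x)]
    have : 0 ≤ D := (norm_nonneg _).trans hb
    rw [abs_of_nonneg this]
    gcongr
  have e4 : ‖(s - x) • ((∫ t in Iic y, l (x, t)) - ∫ t in Iic (q : ℝ), l (x, t))‖
      ≤ c / 4 * ‖s - x‖ := by
    rw [norm_smul, mul_comm]
    gcongr
    exact hb.trans hδ.le
  have e5 : |(∫ u in x..s, ∫ t in Iic (q' : ℝ), ‖l (u, t)‖) -
      ∫ u in x..s, ∫ t in Iic (q : ℝ), ‖l (u, t)‖| ≤ c / 4 * ‖s - x‖ + c / 4 * ‖s - x‖ := by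
    refine le_trans ?_ (add_le_add e2' e3)
    refine le_trans (le_of_eq ?_) (abs_add_le _ _)
    ring_nf
  have e6 := m.trans e5
  have e7 : (∫ u in x..s, ∫ t in Iic y, l (u, t)) - (s - x) • (∫ t in Iic y, l (x, t)) =
      ((∫ u in x..s, ∫ t in Iic y, l (u, t)) - ∫ u in x..s, ∫ t in Iic (q : ℝ), l (u, t)) +
      ((∫ u in x..s, ∫ t in Iic (q : ℝ), l (u, t)) - (s - x) • ∫ t in Iic (q : ℝ), l (x, t)) -
      (s - x) • ((∫ t in Iic y, l (x, t)) - ∫ t in Iic (q : ℝ), l (x, t)) := by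
    rw [smul_sub]; abel
  rw [e7]
  refine (norm_sub_le _ _).trans ?_
  refine (add_le_add (norm_add_le _ _) le_rfl).trans ?_
  linarith

theorem stronglyMeasurable_integral_Iic {E : Type*} [NormedAddCommGroup E] [NormedSpace ℝ E]
    {l : ℝ × ℝ → E} (hm : StronglyMeasurable l) :
    StronglyMeasurable (fun p : ℝ × ℝ => ∫ t in Iic p.2, l (p.1, t)) := by
  have h : StronglyMeasurable (fun w : (ℝ × ℝ) × ℝ =>
      {w : (ℝ × ℝ) × ℝ | w.2 ≤ w.1.2}.indicator (fun w => l (w.1.1, w.2)) w) := by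
    refine StronglyMeasurable.indicator ?_ (measurableSet_le (by fun_prop) (by fun_prop))
    exact hm.comp_measurable (by fun_prop)
  have := h.integral_prod_right' (ν := volume)
  convert this using 2 with p
  rw [← integral_indicator measurableSet_Iic]
  rfl

theorem ae_hasDerivAt_integral_snd {E : Type*} [NormedAddCommGroup E] [NormedSpace ℝ E] [CompleteSpace E]
    {l : ℝ × ℝ → E} (hm : StronglyMeasurable l) (hl : Integrable l) :
    ∀ᵐ p : ℝ × ℝ, HasDerivAt (fun y => ∫ t in Iic y, l (p.1, t)) (l p) p.2 := by
  have H1 : ∀ᵐ x, Integrable (fun t => l (x, t)) := by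
    rw [Measure.volume_eq_prod] at hl
    exact hl.prod_right_ae
  have H1' : ∀ᵐ p : ℝ × ℝ, Integrable (fun t => l (p.1, t)) := by
    rw [Measure.volume_eq_prod]
    exact Measure.quasiMeasurePreserving_fst.ae H1
  let P : ℝ × ℝ → Prop := fun p => ∀ k : ℕ, ∃ m : ℕ, ∀ h : ℚ, |(h : ℝ)| < 1 / ((m : ℝ) + 1) →
    ‖(∫ t in Iic (p.2 + h), l (p.1, t)) - (∫ t in Iic p.2, l (p.1, t)) - (h : ℝ) • l p‖ ≤
      1 / ((k : ℝ) + 1) * |(h : ℝ)|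
  have hG := stronglyMeasurable_integral_Iic hm
  have hP : MeasurableSet {p | P p} := by
    simp only [P, ofPred_forall, ofPred_exists]
    refine MeasurableSet.iInter fun k => MeasurableSet.iUnion fun m => MeasurableSet.iInter fun h =>
      MeasurableSet.iInter fun _ => ?_
    refine measurableSet_le ?_ measurable_const
    refine StronglyMeasurable.measurable ?_
    refine StronglyMeasurable.norm ?_
    refine StronglyMeasurable.sub (StronglyMeasurable.sub ?_ hG) (hm.const_smul _)
    exact hG.comp_measurable (g := fun p : ℝ × ℝ => (p.1, p.2 + (h : ℝ))) (by fun_prop)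
  have hPae : ∀ᵐ p, P p := by
    rw [Measure.volume_eq_prod, Measure.ae_prod_iff_ae_ae hP]
    filter_upwards [H1] with x hx
    filter_upwards [LocallyIntegrable.ae_hasDerivAt_integral hx.locallyIntegrable] with y hy k
    have := Asymptotics.isLittleO_iff.1 (hasDerivAt_iff_isLittleO.1 (hy 0))
      (show 0 < 1 / ((k : ℝ) + 1) by positivity)
    obtain ⟨δ, hδ, hb⟩ := Metric.eventually_nhds_iff.1 this
    obtain ⟨m, hmm⟩ := exists_nat_one_div_lt hδ
    refine ⟨m, fun h hh => ?_⟩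
    have := hb (y := y + h) (by rw [Real.dist_eq]; simpa using hh.trans hmm)
    rw [intervalIntegral.integral_interval_sub_left hx.intervalIntegrable hx.intervalIntegrable,
      ← intervalIntegral.integral_Iic_sub_Iic hx.integrableOn hx.integrableOn] at this
    simpa only [add_sub_cancel_left, Real.norm_eq_abs] using this
  filter_upwards [H1', hPae] with p hp hP
  rw [hasDerivAt_iff_isLittleO, Asymptotics.isLittleO_iff]
  intro c hc
  obtain ⟨k, hk⟩ := exists_nat_one_div_lt hc
  obtain ⟨m, hm⟩ := hP k
  have hcont : Continuous fun b => ∫ t in Iic b, l (p.1, t) := by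
    have := intervalIntegral.continuous_primitive (fun a b => hp.intervalIntegrable (a := a) (b := b)) 0
    have h2 : (fun b => ∫ t in Iic b, l (p.1, t)) =
        fun b => (∫ t in (0 : ℝ)..b, l (p.1, t)) + ∫ t in Iic 0, l (p.1, t) := by
      ext b
      rw [← intervalIntegral.integral_Iic_sub_Iic hp.integrableOn hp.integrableOn]; abel
    rw [h2]; exact this.add continuous_const
  have hr : ∀ h : ℝ, |h| < 1 / ((m : ℝ) + 1) →
    ‖(∫ t in Iic (p.2 + h), l (p.1, t)) - (∫ t in Iic p.2, l (p.1, t)) - (h : ℝ) • l p‖ ≤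
      1 / ((k : ℝ) + 1) * |(h : ℝ)| := by
    intro h hh
    have hh' := abs_lt.1 hh
    have hcl : h ∈ closure (((↑) : ℚ → ℝ) '' univ ∩ Ioo (-(1 / ((m : ℝ) + 1))) (1 / ((m : ℝ) + 1))) := by
      rw [image_univ]
      have := (Rat.denseRange_cast (𝕜 := ℝ)).open_subset_closure_inter
        (isOpen_Ioo (a := (-(1 / ((m : ℝ) + 1)))) (b := (1 / ((m : ℝ) + 1))))
      rw [inter_comm]
      exact this hh'
    have hclosed : IsClosed {h : ℝ | ‖(∫ t in Iic (p.2 + h), l (p.1, t)) -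
        (∫ t in Iic p.2, l (p.1, t)) - (h : ℝ) • l p‖ ≤ 1 / ((k : ℝ) + 1) * |(h : ℝ)|} := by
      refine isClosed_le ?_ (by fun_prop)
      have := hcont.comp (continuous_const_add p.2)
      exact ((this.sub continuous_const).sub (by fun_prop)).norm
    refine hclosed.closure_subset_iff.2 ?_ hcl
    rintro _ ⟨⟨q, -, rfl⟩, hq⟩
    exact hm q (abs_lt.2 hq)
  rw [Metric.eventually_nhds_iff]
  refine ⟨1 / ((m : ℝ) + 1), by positivity, fun y hy => ?_⟩
  have := hr (y - p.2) (by simpa [Real.dist_eq] using hy)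
  rw [add_sub_cancel] at this
  refine this.trans ?_
  rw [Real.norm_eq_abs]
  gcongr

theorem measurableSet_unitSq : MeasurableSet unitSq := measurableSet_Icc.prod measurableSet_Icc

theorem setIntegral_rect {F : Type*} [NormedAddCommGroup F] [NormedSpace ℝ F] [CompleteSpace F]
    {l : ℝ × ℝ → F} (hl : Integrable l) {x y : ℝ} (hx : 0 ≤ x) (hy : 0 ≤ y) :
    ∫ q in rect (x, y), l q = (∫ u in (0 : ℝ)..x, ∫ t in Iic y, l (u, t)) -
      ∫ u in (0 : ℝ)..x, ∫ t in Iic 0, l (u, t) := by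
  have H1 : ∀ᵐ x, Integrable (fun t => l (x, t)) := by
    rw [Measure.volume_eq_prod] at hl
    exact hl.prod_right_ae
  rw [← intervalIntegral.integral_sub (integrable_integral_Iic hl _).intervalIntegrable
    (integrable_integral_Iic hl _).intervalIntegrable, rect, Measure.volume_eq_prod, setIntegral_prod]
  · rw [integral_Icc_eq_integral_Ioc, intervalIntegral.integral_of_le hx]
    refine integral_congr_ae (ae_restrict_of_ae ?_)
    filter_upwards [H1] with u hu
    rw [intervalIntegral.integral_Iic_sub_Iic hu.integrableOn hu.integrableOn,
      intervalIntegral.integral_of_le hy, integral_Icc_eq_integral_Ioc]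
  · rw [← Measure.volume_eq_prod]; exact hl.integrableOn

/-- A function `z(x,y) = ∫₀ˣ∫₀ʸ l` has mixed derivative `z_{xy} = l` almost everywhere. -/
theorem pdy_pdx_ae_eq {F : Type*} [NormedAddCommGroup F] [NormedSpace ℝ F] [CompleteSpace F]
    {l z : ℝ × ℝ → F} (hl : IntegrableOn l unitSq) (hz : ∀ p ∈ unitSq, z p = ∫ q in rect p, l q) :
    pdy (pdx z) =ᵐ[volume.restrict unitSq] l := by
  obtain ⟨k, hkm, hki, hlk⟩ : ∃ k : ℝ × ℝ → F, StronglyMeasurable k ∧ Integrable k ∧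
      l =ᵐ[volume.restrict unitSq] k := by
    have h1 := (integrable_indicator_iff measurableSet_unitSq).2 hl
    refine ⟨h1.1.mk _, h1.1.stronglyMeasurable_mk, h1.congr h1.1.ae_eq_mk, ?_⟩
    refine (indicator_ae_eq_restrict measurableSet_unitSq).symm.trans ?_
    exact ae_restrict_of_ae h1.1.ae_eq_mk
  have hz' : ∀ x ∈ Icc (0 : ℝ) 1, ∀ y ∈ Icc (0 : ℝ) 1,
      z (x, y) = (∫ u in (0 : ℝ)..x, ∫ t in Iic y, k (u, t)) -
        ∫ u in (0 : ℝ)..x, ∫ t in Iic 0, k (u, t) := by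
    intro x hx y hy
    rw [hz (x, y) ⟨hx, hy⟩, ← setIntegral_rect hki hx.1 hy.1]
    refine integral_congr_ae (ae_restrict_of_ae_restrict_of_subset ?_ hlk)
    exact prod_mono (Icc_subset_Icc_right hx.2) (Icc_subset_Icc_right hy.2)
  refine EventuallyEq.trans ?_ hlk.symm
  have hx : ∀ᵐ x, x ∈ Icc (0 : ℝ) 1 → ∀ y ∈ Icc (0 : ℝ) 1, pdx z (x, y) =
      (∫ t in Iic y, k (x, t)) - ∫ t in Iic 0, k (x, t) := by
    filter_upwards [ae_forall_hasDerivAt_integral_fst hki] with x hx hx1 y hy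
    have := ((hx y).sub (hx 0)).hasDerivWithinAt (s := Icc (0 : ℝ) 1)
    refine HasDerivWithinAt.derivWithin ?_ (uniqueDiffOn_Icc zero_lt_one x hx1)
    refine this.congr (fun s hs => ?_) ?_
    · exact hz' s hs y hy
    · exact hz' x hx1 y hy
  have hx' : ∀ᵐ p : ℝ × ℝ, p.1 ∈ Icc (0 : ℝ) 1 → ∀ y ∈ Icc (0 : ℝ) 1, pdx z (p.1, y) =
      (∫ t in Iic y, k (p.1, t)) - ∫ t in Iic 0, k (p.1, t) := by
    rw [Measure.volume_eq_prod]
    exact Measure.quasiMeasurePreserving_fst.ae hx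
  filter_upwards [ae_restrict_mem measurableSet_unitSq, ae_restrict_of_ae hx',
    ae_restrict_of_ae (ae_hasDerivAt_integral_snd hkm hki)] with p hp h1 h2
  have := (h2.sub_const (∫ t in Iic 0, k (p.1, t))).hasDerivWithinAt (s := Icc (0 : ℝ) 1)
  refine HasDerivWithinAt.derivWithin ?_ (uniqueDiffOn_Icc zero_lt_one _ hp.2)
  refine this.congr (fun s hs => ?_) ?_
  · exact h1 hp.1 s hs
  · exact h1 hp.1 _ hp.2

theorem AbsContSq.eq_integral {F : Type*} [NormedAddCommGroup F] [NormedSpace ℝ F]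
    [CompleteSpace F] {z : ℝ × ℝ → F} (hz : AbsContSq z)
    (h₁ : ∀ x ∈ Icc (0 : ℝ) 1, z (x, 0) = 0) (h₂ : ∀ y ∈ Icc (0 : ℝ) 1, z (0, y) = 0) :
    IntegrableOn (pdy (pdx z)) unitSq ∧
      ∀ p ∈ unitSq, z p = ∫ q in rect p, pdy (pdx z) q := by
  obtain ⟨l, l₁, l₂, c, hl, -, -, hz⟩ := hz
  have hv : ∀ p : ℝ × ℝ, p.1 = 0 ∨ p.2 = 0 → ∫ q in rect p, l q = 0 := by
    intro p hp
    have : volume (rect p) = 0 := by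
      rw [rect, Measure.volume_eq_prod, Measure.prod_prod]
      rcases hp with h | h <;> simp [h]
    rw [Measure.restrict_eq_zero.2 this, integral_zero_measure]
  have z01 : (0 : ℝ) ∈ Icc (0 : ℝ) 1 := by simp
  have hc : c = 0 := by
    have := hz (0, 0) ⟨z01, z01⟩
    rw [h₁ 0 z01, hv _ (Or.inl rfl)] at this
    simpa using this.symm
  have hl : IntegrableOn l unitSq ∧ ∀ p ∈ unitSq, z p = ∫ q in rect p, l q := by
    refine ⟨hl, fun p hp => ?_⟩
    have e1 := hz (p.1, 0) ⟨hp.1, z01⟩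
    rw [h₁ _ hp.1, hv _ (Or.inr rfl)] at e1
    have e2 := hz (0, p.2) ⟨z01, hp.2⟩
    rw [h₂ _ hp.2, hv _ (Or.inl rfl)] at e2
    rw [hz p hp]
    simp [hc] at e1 e2 ⊢
    rw [← e1, ← e2]; simp
  have ae := pdy_pdx_ae_eq hl.1 hl.2
  refine ⟨hl.1.congr ae.symm, fun p hp => ?_⟩
  rw [hl.2 p hp]
  refine integral_congr_ae (ae_restrict_of_ae_restrict_of_subset ?_ ae.symm)
  exact prod_mono (Icc_subset_Icc_right hp.1.2) (Icc_subset_Icc_right hp.2.2)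

/-! ### The space `AC₀²(Q, ℝⁿ)` -/

/-- `ℝⁿ` with the Euclidean norm. -/
abbrev Vec (n : ℕ) : Type := EuclideanSpace ℝ (Fin n)

/-- `L²(Q, ℝⁿ)`. -/
abbrev L2Sq (n : ℕ) : Type := Lp (Vec n) 2 (volume.restrict unitSq)

/-- Membership in `AC₀²(Q, ℝⁿ)`: absolutely continuous on `Q`, zero on the two sides `y = 0` and
`x = 0`, with square integrable mixed derivative `z_{xy}`. A function on `Q` is represented by its
extension by zero to the plane. -/
structure MemAC02 {n : ℕ} (z : ℝ × ℝ → Vec n) : Prop where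
  absCont : AbsContSq z
  bottom : ∀ x ∈ Icc (0 : ℝ) 1, z (x, 0) = 0
  left : ∀ y ∈ Icc (0 : ℝ) 1, z (0, y) = 0
  memLp : MemLp (pdy (pdx z)) 2 (volume.restrict unitSq)
  outside : ∀ p ∉ unitSq, z p = 0

theorem MemAC02.integrableOn {n : ℕ} {z : ℝ × ℝ → Vec n} (hz : MemAC02 z) :
    IntegrableOn (pdy (pdx z)) unitSq :=
  (hz.absCont.eq_integral hz.bottom hz.left).1

theorem MemAC02.eq_integral {n : ℕ} {z : ℝ × ℝ → Vec n} (hz : MemAC02 z) :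
    ∀ p ∈ unitSq, z p = ∫ q in rect p, pdy (pdx z) q :=
  (hz.absCont.eq_integral hz.bottom hz.left).2

theorem integrableOn_rect {F : Type*} [NormedAddCommGroup F] {l : ℝ × ℝ → F}
    (hl : IntegrableOn l unitSq) {p : ℝ × ℝ} (hp : p ∈ unitSq) : IntegrableOn l (rect p) :=
  hl.mono_set (prod_mono (Icc_subset_Icc_right hp.1.2) (Icc_subset_Icc_right hp.2.2))

theorem memAC02_of_integral {n : ℕ} {z l : ℝ × ℝ → Vec n}
    (hl : MemLp l 2 (volume.restrict unitSq)) (hz : ∀ p ∈ unitSq, z p = ∫ q in rect p, l q)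
    (h0 : ∀ p ∉ unitSq, z p = 0) :
    MemAC02 z ∧ pdy (pdx z) =ᵐ[volume.restrict unitSq] l := by
  have hfin : IsFiniteMeasure (volume.restrict unitSq) :=
    ⟨by
      rw [Measure.restrict_apply_univ]
      exact (isCompact_Icc.prod isCompact_Icc).measure_lt_top⟩
  have hi : IntegrableOn l unitSq := hl.integrable one_le_two
  have ae := pdy_pdx_ae_eq hi hz
  have hv : ∀ p : ℝ × ℝ, p.1 = 0 ∨ p.2 = 0 → ∫ q in rect p, l q = 0 := by
    intro p hp
    have : volume (rect p) = 0 := by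
      rw [rect, Measure.volume_eq_prod, Measure.prod_prod]
      rcases hp with h | h <;> simp [h]
    rw [Measure.restrict_eq_zero.2 this, integral_zero_measure]
  refine ⟨⟨⟨l, 0, 0, 0, hi, integrableOn_zero, integrableOn_zero, fun p hp => ?_⟩,
    fun x hx => ?_, fun y hy => ?_, hl.ae_eq ae.symm, h0⟩, ae⟩
  · simp [hz p hp]
  · rw [hz (x, 0) ⟨hx, by simp⟩, hv _ (Or.inr rfl)]
  · rw [hz (0, y) ⟨by simp, hy⟩, hv _ (Or.inl rfl)]

theorem MemAC02.add {n : ℕ} {z w : ℝ × ℝ → Vec n} (hz : MemAC02 z) (hw : MemAC02 w) :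
    MemAC02 (z + w) ∧ pdy (pdx (z + w)) =ᵐ[volume.restrict unitSq]
      pdy (pdx z) + pdy (pdx w) := by
  refine memAC02_of_integral (hz.memLp.add hw.memLp) (fun p hp => ?_) fun p hp => ?_
  · simp only [Pi.add_apply]
    rw [integral_add (integrableOn_rect hz.integrableOn hp) (integrableOn_rect hw.integrableOn hp),
      ← hz.eq_integral p hp, ← hw.eq_integral p hp]
  · simp [hz.outside p hp, hw.outside p hp]

theorem MemAC02.smul {n : ℕ} {z : ℝ × ℝ → Vec n} (c : ℝ) (hz : MemAC02 z) :
    MemAC02 (c • z) ∧ pdy (pdx (c • z)) =ᵐ[volume.restrict unitSq] c • pdy (pdx z) := by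
  refine memAC02_of_integral (hz.memLp.const_smul c) (fun p hp => ?_) fun p hp => ?_
  · simp only [Pi.smul_apply]
    rw [integral_smul, ← hz.eq_integral p hp]
  · simp [hz.outside p hp]

/-- `AC₀²(Q, ℝⁿ)` as a vector space of functions. -/
def AC02Submodule (n : ℕ) : Submodule ℝ (ℝ × ℝ → Vec n) where
  carrier := {z | MemAC02 z}
  add_mem' hz hw := (MemAC02.add hz hw).1
  zero_mem' := (memAC02_of_integral (l := 0) MemLp.zero (by simp) (by simp)).1
  smul_mem' c _ hz := (MemAC02.smul c hz).1

/-- The space `AC₀²(Q, ℝⁿ)`. It is a type of its own, so that it carries the topology of the norm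
`‖z_{xy}‖_{L²}` below and not that of pointwise convergence. -/
def AC02 (n : ℕ) : Type := AC02Submodule n

namespace AC02

instance (n : ℕ) : AddCommGroup (AC02 n) := inferInstanceAs (AddCommGroup (AC02Submodule n))

instance (n : ℕ) : Module ℝ (AC02 n) := inferInstanceAs (Module ℝ (AC02Submodule n))

/-- The function that underlies an element of `AC₀²(Q, ℝⁿ)`. -/
def toFun {n : ℕ} (z : AC02 n) : ℝ × ℝ → Vec n := Subtype.val (p := (· ∈ AC02Submodule n)) z

instance (n : ℕ) : CoeFun (AC02 n) (fun _ => ℝ × ℝ → Vec n) := ⟨toFun⟩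

theorem mem {n : ℕ} (z : AC02 n) : MemAC02 z.toFun :=
  Subtype.property (p := (· ∈ AC02Submodule n)) z

/-- The linear map `z ↦ z_{xy}` from `AC₀²(Q, ℝⁿ)` to `L²(Q, ℝⁿ)`. -/
noncomputable def mixed (n : ℕ) : AC02 n →ₗ[ℝ] L2Sq n where
  toFun z := z.mem.memLp.toLp (pdy (pdx z.toFun))
  map_add' z w := by
    rw [← MemLp.toLp_add]
    exact MemLp.toLp_congr _ _ (MemAC02.add z.mem w.mem).2
  map_smul' c z := by
    rw [RingHom.id_apply, ← MemLp.toLp_const_smul]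
    exact MemLp.toLp_congr _ _ (MemAC02.smul c z.mem).2

theorem mixed_injective (n : ℕ) : Function.Injective (mixed n) := by
  intro z w h
  have h' := (MemLp.toLp_eq_toLp_iff z.mem.memLp w.mem.memLp).1 h
  refine Subtype.ext (funext fun p => ?_)
  change z.toFun p = w.toFun p
  by_cases hp : p ∈ unitSq
  · rw [z.mem.eq_integral p hp, w.mem.eq_integral p hp]
    refine integral_congr_ae (ae_restrict_of_ae_restrict_of_subset ?_ h')
    exact prod_mono (Icc_subset_Icc_right hp.1.2) (Icc_subset_Icc_right hp.2.2)
  · rw [z.mem.outside p hp, w.mem.outside p hp]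

/-- The norm `‖z‖ = ‖z_{xy}‖_{L²}`. -/
noncomputable instance (n : ℕ) : NormedAddCommGroup (AC02 n) :=
  NormedAddCommGroup.induced (AC02 n) (L2Sq n) (mixed n) (mixed_injective n)

noncomputable instance (n : ℕ) : NormedSpace ℝ (AC02 n) :=
  NormedSpace.induced ℝ (AC02 n) (L2Sq n) (mixed n)

theorem norm_def {n : ℕ} (z : AC02 n) : ‖z‖ = ‖mixed n z‖ := rfl

end AC02

/-! ### The system and the assumptions on its data -/

/-- Measurability and differentiability of the data. The `n × n` matrices `A¹(x,y)`, `A²(x,y)` are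
linear maps of `ℝⁿ`, with the operator norm; `MemLp _ ∞` means measurable and essentially
bounded. -/
structure RegularData {n : ℕ} (f₁ f₂ : ℝ × ℝ → Vec n → Vec n)
    (A₁ A₂ : ℝ × ℝ → Vec n →L[ℝ] Vec n) : Prop where
  meas_f₁ : ∀ z, AEStronglyMeasurable (fun p => f₁ p z) (volume.restrict unitSq)
  meas_f₂ : ∀ z, AEStronglyMeasurable (fun p => f₂ p z) (volume.restrict unitSq)
  contDiff_f₁ : ∀ᵐ p ∂volume.restrict unitSq, ContDiff ℝ 1 (f₁ p)
  contDiff_f₂ : ∀ᵐ p ∂volume.restrict unitSq, ContDiff ℝ 1 (f₂ p)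
  diff_A₁ : ∀ᵐ y ∂volume.restrict (Icc (0 : ℝ) 1),
    DifferentiableOn ℝ (fun x => A₁ (x, y)) (Icc 0 1)
  diff_A₂ : ∀ᵐ x ∂volume.restrict (Icc (0 : ℝ) 1),
    DifferentiableOn ℝ (fun y => A₂ (x, y)) (Icc 0 1)
  memLp_A₁ : MemLp A₁ ∞ (volume.restrict unitSq)
  memLp_A₂ : MemLp A₂ ∞ (volume.restrict unitSq)
  memLp_pdx_A₁ : MemLp (pdx A₁) ∞ (volume.restrict unitSq)
  memLp_pdy_A₂ : MemLp (pdy A₂) ∞ (volume.restrict unitSq)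

/-- Linear growth of `f¹`, `f²` in `z` and boundedness of `A¹`, `A²`, `A¹_x`, `A²_y`. -/
def LinearGrowth {n : ℕ} (f₁ f₂ : ℝ × ℝ → Vec n → Vec n)
    (A₁ A₂ : ℝ × ℝ → Vec n →L[ℝ] Vec n) : Prop :=
  ∃ B > (0 : ℝ), ∃ b : ℝ × ℝ → ℝ, MemLp b 2 (volume.restrict unitSq) ∧
    ∀ᵐ p ∂volume.restrict unitSq, 0 ≤ b p ∧
      (∀ z, ‖f₁ p z‖ ≤ B * ‖z‖ + b p ∧ ‖f₂ p z‖ ≤ B * ‖z‖ + b p) ∧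
      ‖A₁ p‖ ≤ B ∧ ‖A₂ p‖ ≤ B ∧ ‖pdx A₁ p‖ ≤ B ∧ ‖pdy A₂ p‖ ≤ B

/-- The derivatives `f¹_z`, `f²_z` are bounded on bounded sets. -/
def DerivBoundedOnBounded {n : ℕ} (f₁ f₂ : ℝ × ℝ → Vec n → Vec n) : Prop :=
  ∀ ρ > (0 : ℝ), ∃ M : ℝ, ∀ᵐ p ∂volume.restrict unitSq, ∀ z, ‖z‖ ≤ ρ →
    ‖fderiv ℝ (f₁ p) z‖ ≤ M ∧ ‖fderiv ℝ (f₂ p) z‖ ≤ M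

/-- `z` solves, for almost every `(x,y)` in the square,
`z_{xy} + f¹(x,y,z) + ∫₀ˣ∫₀ʸ (f²(s,t,z) + A¹ z_x + A² z_y) ds dt = v(x,y)`; the zero boundary
conditions are part of `z ∈ AC₀²`. -/
structure IsSolution {n : ℕ} (f₁ f₂ : ℝ × ℝ → Vec n → Vec n)
    (A₁ A₂ : ℝ × ℝ → Vec n →L[ℝ] Vec n) (v : L2Sq n) (z : AC02 n) : Prop where
  integrable : IntegrableOn (fun q => f₂ q (z q) + A₁ q (pdx z q) + A₂ q (pdy z q)) unitSq
  equation : ∀ᵐ p ∂volume.restrict unitSq,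
    pdy (pdx z) p + f₁ p (z p) +
      ∫ q in rect p, (f₂ q (z q) + A₁ q (pdx z q) + A₂ q (pdy z q)) = v p

end TwoDSystem

open TwoDSystem

/-!
In terms of the mixed derivative `l = z_{xy}` the system is an equation in `L²(Q, ℝⁿ)`. An element
`z` of `AC₀²` is the double integral `prim l`, with `z_x = ∫₀ʸ l` and `z_y = ∫₀ˣ l` almost
everywhere, and `z ↦ z_{xy}` is an isometry onto `L²` (`AC02.mixedEquiv`). So the system reads
`l + T l = v` (`isSolution_iff`), where `T` is the operator `systemOp`.

Everything rests on one pointwise bound: as long as the nonlinear terms are Lipschitz in `z`,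
`|T l - T m|(x,y) ≤ C ∫₀ˣ∫₀ʸ |l - m|`. The terms with `z_x` and `z_y` obey it because they stand under
a double integral, which absorbs the partial integrals `∫₀ʸ` and `∫₀ˣ` (`enorm_add_primL_le`); no
derivative of `A¹` or `A²` is needed. The double integral contracts the `L¹` norm with weight
`exp (-k x)`. Hence a map with this bound (`VolterraLipschitz`) satisfies a Gronwall inequality, an
iterate of `l ↦ v - T l` is a contraction of `L²`, and `l + T l = v` has a unique solution that is
Lipschitz in `v`.

The nonlinear terms are Lipschitz on bounded sets only. Linear growth and the Gronwall inequality
bound `z` uniformly in terms of `‖v‖` (`exists_prim_bound`), with a bound that is the same for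
all radial truncations of `f¹` and `f²`. So for `v` in a bounded set `f¹` and `f²` may be truncated,
which makes them Lipschitz.

The map `l ↦ f(·, prim l)` is Fréchet differentiable in `L²` because `prim l` is bounded by `‖l‖`
(`Caratheodory.exists_hasFDerivAt_op`, by dominated convergence). The derivative of `l + T l` is the
identity plus a linear map with the Volterra bound, hence invertible; with the continuity of the
solution operator this gives its differentiability.
-/

namespace TwoDSystem
open scoped NNReal

/-! ### Two-dimensional Gronwall inequality -/

theorem restrict_unitSq_eq_prod : (volume.restrict unitSq : Measure (ℝ × ℝ)) =
    (volume.restrict (Icc (0 : ℝ) 1)).prod (volume.restrict (Icc (0 : ℝ) 1)) := by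
  rw [unitSq, Measure.volume_eq_prod, Measure.prod_restrict]

instance isProbabilityMeasure_restrict_Icc :
    IsProbabilityMeasure (volume.restrict (Icc (0 : ℝ) 1)) :=
  ⟨by simp⟩

instance isProbabilityMeasure_restrict_unitSq :
    IsProbabilityMeasure (volume.restrict unitSq : Measure (ℝ × ℝ)) := by
  rw [restrict_unitSq_eq_prod]; infer_instance

theorem rect_subset_unitSq {p : ℝ × ℝ} (hp : p ∈ unitSq) : rect p ⊆ unitSq :=
  prod_mono (Icc_subset_Icc_right hp.1.2) (Icc_subset_Icc_right hp.2.2)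

theorem lintegral_rect_le {p : ℝ × ℝ} (hp : p ∈ unitSq) (u : ℝ × ℝ → ℝ≥0∞) :
    ∫⁻ q in rect p, u q ≤ ∫⁻ q in unitSq, u q :=
  lintegral_mono_set (rect_subset_unitSq hp)

theorem ae_restrict_rect {p : ℝ × ℝ} (hp : p ∈ unitSq) {P : ℝ × ℝ → Prop}
    (h : ∀ᵐ q ∂volume.restrict unitSq, P q) : ∀ᵐ q ∂volume.restrict (rect p), P q :=
  ae_restrict_of_ae_restrict_of_subset (rect_subset_unitSq hp) h

/-- The weight `exp (-k x)` on the square. Weighting by the first variable alone already turns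
the Volterra operator `u ↦ ∫₀ˣ∫₀ʸ u` into a contraction. -/
noncomputable def expWeight (k : ℝ) (p : ℝ × ℝ) : ℝ≥0∞ := ENNReal.ofReal (Real.exp (-k * p.1))

theorem measurable_expWeight (k : ℝ) : Measurable (expWeight k) := by
  unfold expWeight; fun_prop

theorem expWeight_le_one {k : ℝ} (hk : 0 ≤ k) {p : ℝ × ℝ} (hp : p ∈ unitSq) :
    expWeight k p ≤ 1 := by
  rw [expWeight, ← ENNReal.ofReal_one]
  refine ENNReal.ofReal_le_ofReal (Real.exp_le_one_iff.2 ?_)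
  nlinarith [hp.1.1]

theorem one_le_exp_mul_expWeight {k : ℝ} (hk : 0 ≤ k) {p : ℝ × ℝ} (hp : p ∈ unitSq) :
    1 ≤ ENNReal.ofReal (Real.exp k) * expWeight k p := by
  rw [expWeight, ← ENNReal.ofReal_mul (Real.exp_pos _).le, ← Real.exp_add, ← ENNReal.ofReal_one]
  refine ENNReal.ofReal_le_ofReal (Real.one_le_exp ?_)
  nlinarith [hp.1.2]

theorem lintegral_expWeight_tail_le {k : ℝ} (hk : 0 < k) (q : ℝ × ℝ) :
    ∫⁻ p in unitSq, {p : ℝ × ℝ | q.1 ≤ p.1}.indicator (expWeight k) p ≤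
      ENNReal.ofReal k⁻¹ * expWeight k q := by
  have e : ∀ p : ℝ × ℝ, {p : ℝ × ℝ | q.1 ≤ p.1}.indicator (expWeight k) p =
      (Ici q.1).indicator (fun x => ENNReal.ofReal (Real.exp (-k * x))) p.1 := by
    intro p
    simp only [indicator_apply, mem_ofPred_eq, mem_Ici, expWeight]
  have hm : Measurable ((Ici q.1).indicator (fun x => ENNReal.ofReal (Real.exp (-k * x)))) :=
    Measurable.indicator (by fun_prop) measurableSet_Ici
  simp only [e]
  rw [restrict_unitSq_eq_prod, lintegral_prod (fun p : ℝ × ℝ =>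
    (Ici q.1).indicator (fun x => ENNReal.ofReal (Real.exp (-k * x))) p.1)
    (hm.comp measurable_fst).aemeasurable]
  simp only [lintegral_const, measure_univ, mul_one]
  refine (setLIntegral_le_lintegral _ _).trans ?_
  rw [lintegral_indicator measurableSet_Ici, setLIntegral_congr Ioi_ae_eq_Ici.symm,
    ← ofReal_integral_eq_lintegral_ofReal
      (integrableOn_exp_mul_Ioi (show -k < 0 by linarith) q.1)
      (Eventually.of_forall fun _ => (Real.exp_pos _).le),
    integral_exp_mul_Ioi (by linarith), expWeight, ← ENNReal.ofReal_mul (by positivity)]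
  refine le_of_eq ?_
  congr 1
  field_simp

/-- The Volterra operator contracts the weighted `L¹` norm by the factor `1 / k`. -/
theorem lintegral_expWeight_mul_rect_le {k : ℝ} (hk : 0 < k) {u : ℝ × ℝ → ℝ≥0∞}
    (hu : AEMeasurable u (volume.restrict unitSq)) :
    ∫⁻ p in unitSq, expWeight k p * ∫⁻ q in rect p, u q ≤
      ENNReal.ofReal k⁻¹ * ∫⁻ p in unitSq, expWeight k p * u p := by
  have h1 : ∫⁻ p in unitSq, expWeight k p * ∫⁻ q in rect p, u q ≤
      ∫⁻ p in unitSq, ∫⁻ q in unitSq,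
        {p : ℝ × ℝ | q.1 ≤ p.1}.indicator (expWeight k) p * u q := by
    refine setLIntegral_mono' measurableSet_unitSq fun p hp => ?_
    rw [← lintegral_const_mul' (expWeight k p) _ ENNReal.ofReal_ne_top]
    refine le_trans (le_of_eq ?_) (lintegral_mono_set (rect_subset_unitSq hp))
    refine setLIntegral_congr_fun (measurableSet_Icc.prod measurableSet_Icc) fun q hq => ?_
    have : q.1 ≤ p.1 := hq.1.2
    simp [this]
  refine h1.trans ?_
  rw [lintegral_lintegral_swap]
  · rw [← lintegral_const_mul' _ _ ENNReal.ofReal_ne_top]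
    refine lintegral_mono fun q => ?_
    rw [lintegral_mul_const _ ((measurable_expWeight k).indicator
      (measurableSet_le measurable_const measurable_fst)), ← mul_assoc]
    gcongr
    exact lintegral_expWeight_tail_le hk q
  · refine AEMeasurable.mul ?_ hu.comp_snd
    have hs : MeasurableSet {w : (ℝ × ℝ) × ℝ × ℝ | w.2.1 ≤ w.1.1} :=
      measurableSet_le (by fun_prop) (by fun_prop)
    exact (((measurable_expWeight k).comp measurable_fst).indicator hs).aemeasurable

/-- The constant of the Gronwall inequality `lintegral_le_of_le_add_rect`. -/
noncomputable def gronwallConst (C : ℝ≥0) : ℝ≥0 := 2 * Real.toNNReal (Real.exp (2 * C + 1))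

theorem two_mul_ofReal_exp (C : ℝ≥0) :
    ENNReal.ofReal (Real.exp (2 * C + 1)) * 2 = gronwallConst C := by
  rw [gronwallConst, ENNReal.coe_mul, mul_comm]; rfl

theorem mul_ofReal_inv_le_half (C : ℝ≥0) :
    (C : ℝ≥0∞) * ENNReal.ofReal (2 * C + 1 : ℝ)⁻¹ ≤ 2⁻¹ := by
  have h2 : (2⁻¹ : ℝ≥0∞) = ENNReal.ofReal 2⁻¹ := by
    rw [ENNReal.ofReal_inv_of_pos (by norm_num)]; simp
  rw [← ENNReal.ofReal_coe_nnreal, ← ENNReal.ofReal_mul C.coe_nonneg, h2]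
  refine ENNReal.ofReal_le_ofReal ?_
  have := C.coe_nonneg
  rw [← div_eq_mul_inv, div_le_iff₀ (by positivity)]
  linarith

theorem lintegral_le_exp_mul {k : ℝ} (hk : 0 ≤ k) (u : ℝ × ℝ → ℝ≥0∞) :
    ∫⁻ p in unitSq, u p ≤
      ENNReal.ofReal (Real.exp k) * ∫⁻ p in unitSq, expWeight k p * u p := by
  rw [← lintegral_const_mul' _ _ ENNReal.ofReal_ne_top]
  refine setLIntegral_mono' measurableSet_unitSq fun p hp => ?_
  rw [← mul_assoc]
  exact le_mul_of_one_le_left' (one_le_exp_mul_expWeight hk hp)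

theorem lintegral_expWeight_mul_le {k : ℝ} (hk : 0 ≤ k) (u : ℝ × ℝ → ℝ≥0∞) :
    ∫⁻ p in unitSq, expWeight k p * u p ≤ ∫⁻ p in unitSq, u p :=
  setLIntegral_mono' measurableSet_unitSq fun _ hp => mul_le_of_le_one_left' (expWeight_le_one hk hp)

/-- Gronwall inequality on the square: if `u ≤ g + C ∫₀ˣ∫₀ʸ u`, then the integral of `u` is at
most a constant times the integral of `g`. -/
theorem lintegral_le_of_le_add_rect {C : ℝ≥0} {u g : ℝ × ℝ → ℝ≥0∞}
    (hu : AEMeasurable u (volume.restrict unitSq)) (hg : AEMeasurable g (volume.restrict unitSq))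
    (hfin : ∫⁻ p in unitSq, u p ≠ ∞)
    (h : ∀ᵐ p ∂volume.restrict unitSq, u p ≤ g p + C * ∫⁻ q in rect p, u q) :
    ∫⁻ p in unitSq, u p ≤ gronwallConst C * ∫⁻ p in unitSq, g p := by
  -- With `k > 2 C` the integral term is at most half of the weighted norm of `u`.
  set k : ℝ := 2 * C + 1 with hk
  have hk0 : 0 < k := by positivity
  set N := ∫⁻ p in unitSq, expWeight k p * u p with hN
  have hNfin : N ≠ ∞ := ne_top_of_le_ne_top hfin (lintegral_expWeight_mul_le hk0.le u)
  have h1 : N ≤ (∫⁻ p in unitSq, g p) + 2⁻¹ * N := by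
    calc N ≤ ∫⁻ p in unitSq, (expWeight k p * g p +
          C * (expWeight k p * ∫⁻ q in rect p, u q)) := by
          refine lintegral_mono_ae ?_
          filter_upwards [h] with p hp
          calc expWeight k p * u p ≤ expWeight k p * (g p + C * ∫⁻ q in rect p, u q) := by gcongr
            _ = _ := by ring
      _ = (∫⁻ p in unitSq, expWeight k p * g p) +
          C * ∫⁻ p in unitSq, expWeight k p * ∫⁻ q in rect p, u q := by
          rw [← lintegral_const_mul' (C : ℝ≥0∞) _ ENNReal.coe_ne_top]
          exact lintegral_add_left' ((measurable_expWeight k).aemeasurable.mul hg) _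
      _ ≤ (∫⁻ p in unitSq, g p) + C * (ENNReal.ofReal k⁻¹ * N) := by
          refine add_le_add (lintegral_expWeight_mul_le hk0.le g) ?_
          exact mul_le_mul_right (lintegral_expWeight_mul_rect_le hk0 hu) _
      _ ≤ _ := by
          rw [← mul_assoc]
          gcongr
          exact mul_ofReal_inv_le_half C
  have h2 : N ≤ 2 * ∫⁻ p in unitSq, g p := by
    have e : N = 2⁻¹ * N + 2⁻¹ * N := by
      rw [← add_mul, ENNReal.inv_two_add_inv_two, one_mul]
    have hf : 2⁻¹ * N ≠ ∞ := ENNReal.mul_ne_top (by simp) hNfin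
    nth_rewrite 1 [e] at h1
    have h3 := (ENNReal.add_le_add_iff_right hf).1 h1
    calc N = 2 * (2⁻¹ * N) := by
          rw [← mul_assoc, ENNReal.mul_inv_cancel (by simp) (by simp), one_mul]
      _ ≤ _ := by gcongr
  calc ∫⁻ p in unitSq, u p ≤ ENNReal.ofReal (Real.exp k) * N := lintegral_le_exp_mul hk0.le u
    _ ≤ ENNReal.ofReal (Real.exp k) * (2 * ∫⁻ p in unitSq, g p) := by gcongr
    _ = _ := by rw [← mul_assoc, hk, two_mul_ofReal_exp]

/-! ### Volterra equations in `L²(Q, ℝⁿ)` -/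

theorem lintegral_enorm_le_enorm {n : ℕ} (l : L2Sq n) :
    ∫⁻ p in unitSq, ‖l p‖ₑ ≤ ‖l‖ₑ := by
  rw [← eLpNorm_one_eq_lintegral_enorm, Lp.enorm_def]
  exact eLpNorm_le_eLpNorm_of_exponent_le one_le_two (Lp.aestronglyMeasurable l)

theorem lintegral_enorm_ne_top {n : ℕ} (l : L2Sq n) : ∫⁻ p in unitSq, ‖l p‖ₑ ≠ ∞ :=
  ne_top_of_le_ne_top enorm_ne_top (lintegral_enorm_le_enorm l)

theorem aemeasurable_enorm_coe {n : ℕ} (l : L2Sq n) :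
    AEMeasurable (fun p => ‖l p‖ₑ) (volume.restrict unitSq) :=
  (Lp.aestronglyMeasurable l).enorm

/-- The norm bound in `L²` that follows from a pointwise bound by a function and a constant. -/
theorem enorm_le_of_ae_enorm_le_add {n : ℕ} {d g : L2Sq n} {c : ℝ≥0∞}
    (h : ∀ᵐ p ∂volume.restrict unitSq, ‖d p‖ₑ ≤ ‖g p‖ₑ + c) : ‖d‖ₑ ≤ ‖g‖ₑ + c := by
  have h' : ∀ᵐ p ∂volume.restrict unitSq, ‖d p‖ₑ ≤ ‖‖g p‖ₑ + c‖ₑ := h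
  have hg : AEStronglyMeasurable (fun p => ‖g p‖ₑ) (volume.restrict unitSq) :=
    (aemeasurable_enorm_coe g).aestronglyMeasurable
  have hc : AEStronglyMeasurable (fun _ : ℝ × ℝ => c) (volume.restrict unitSq) :=
    aestronglyMeasurable_const
  have h1 := eLpNorm_add_le hg hc (p := 2) one_le_two
  rw [eLpNorm_const c (by simp) (IsProbabilityMeasure.ne_zero _), measure_univ,
    ENNReal.one_rpow, mul_one, eLpNorm_enorm, enorm_eq_self] at h1
  rw [Lp.enorm_def, Lp.enorm_def]
  exact (eLpNorm_mono_enorm_ae h').trans h1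

/-- The Gronwall inequality in `L²(Q, ℝⁿ)`. -/
theorem enorm_le_gronwall {n : ℕ} {C : ℝ≥0} {d g : L2Sq n}
    (h : ∀ᵐ p ∂volume.restrict unitSq, ‖d p‖ₑ ≤ ‖g p‖ₑ + C * ∫⁻ q in rect p, ‖d q‖ₑ) :
    ‖d‖ₑ ≤ (1 + C * gronwallConst C : ℝ≥0) * ‖g‖ₑ := by
  have h1 := lintegral_le_of_le_add_rect (aemeasurable_enorm_coe d) (aemeasurable_enorm_coe g)
    (lintegral_enorm_ne_top d) h
  have h2 : ‖d‖ₑ ≤ ‖g‖ₑ + C * (gronwallConst C * ‖g‖ₑ) := by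
    refine enorm_le_of_ae_enorm_le_add ?_
    filter_upwards [h, ae_restrict_mem measurableSet_unitSq] with p hp hpQ
    refine hp.trans ?_
    gcongr
    refine (lintegral_rect_le hpQ _).trans (h1.trans ?_)
    gcongr
    exact lintegral_enorm_le_enorm g
  refine h2.trans (le_of_eq ?_)
  push_cast
  ring

/-- A map `T` of `L²(Q, ℝⁿ)` is Volterra–Lipschitz with constant `C` if almost everywhere
`|T l - T m|(x,y) ≤ C ∫₀ˣ∫₀ʸ |l - m|`. -/
def VolterraLipschitz {n : ℕ} (C : ℝ≥0) (T : L2Sq n → L2Sq n) : Prop :=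
  ∀ l m : L2Sq n, ∀ᵐ p ∂volume.restrict unitSq,
    ‖T l p - T m p‖ₑ ≤ C * ∫⁻ q in rect p, ‖l q - m q‖ₑ

theorem lintegral_rect_sub {n : ℕ} (l m : L2Sq n) {p : ℝ × ℝ} (hp : p ∈ unitSq) :
    ∫⁻ q in rect p, ‖(l - m) q‖ₑ = ∫⁻ q in rect p, ‖l q - m q‖ₑ := by
  refine lintegral_congr_ae (ae_restrict_rect hp ?_)
  filter_upwards [Lp.coeFn_sub l m] with q hq
  rw [hq, Pi.sub_apply]

/-- Solutions of `l + T l = v` depend Lipschitz continuously on `v`. The Volterra bound is only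
asked for the two solutions at hand. -/
theorem enorm_sub_le_of_add_eq {n : ℕ} {C : ℝ≥0} {T : L2Sq n → L2Sq n} {l m v w : L2Sq n}
    (hT : ∀ᵐ p ∂volume.restrict unitSq,
      ‖T l p - T m p‖ₑ ≤ C * ∫⁻ q in rect p, ‖l q - m q‖ₑ)
    (hl : l + T l = v) (hm : m + T m = w) :
    ‖l - m‖ₑ ≤ (1 + C * gronwallConst C : ℝ≥0) * ‖v - w‖ₑ := by
  refine enorm_le_gronwall ?_
  have e : l - m = (v - w) - (T l - T m) := by rw [← hl, ← hm]; abel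
  have e1 := Lp.coeFn_sub (v - w) (T l - T m)
  rw [← e] at e1
  filter_upwards [hT, e1, Lp.coeFn_sub (T l) (T m), ae_restrict_mem measurableSet_unitSq]
    with p h1 h2 h3 hp
  rw [h2, Pi.sub_apply, h3, Pi.sub_apply, lintegral_rect_sub l m hp]
  exact enorm_sub_le.trans (by gcongr)

namespace VolterraLipschitz

/-- In the weighted `L¹` norm every iteration gains a factor `1/2`. -/
theorem lintegral_expWeight_iterate_le {n : ℕ} {C : ℝ≥0} {T : L2Sq n → L2Sq n}
    (hT : VolterraLipschitz C T) (l m : L2Sq n) (j : ℕ) :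
    ∫⁻ p in unitSq, expWeight (2 * C + 1) p * ‖T^[j] l p - T^[j] m p‖ₑ ≤
      2⁻¹ ^ j * ∫⁻ p in unitSq, ‖l p - m p‖ₑ := by
  have hk0 : (0 : ℝ) < 2 * C + 1 := by positivity
  induction j with
  | zero => simpa using lintegral_expWeight_mul_le hk0.le _
  | succ j ih =>
    simp only [Function.iterate_succ_apply']
    calc _ ≤ ∫⁻ p in unitSq, C * (expWeight (2 * C + 1) p *
          ∫⁻ q in rect p, ‖T^[j] l q - T^[j] m q‖ₑ) := by
          refine lintegral_mono_ae ?_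
          filter_upwards [hT (T^[j] l) (T^[j] m)] with p hp
          calc _ ≤ expWeight (2 * C + 1) p *
                (C * ∫⁻ q in rect p, ‖T^[j] l q - T^[j] m q‖ₑ) := by gcongr
            _ = _ := by ring
      _ ≤ C * (ENNReal.ofReal (2 * C + 1 : ℝ)⁻¹ *
          ∫⁻ p in unitSq, expWeight (2 * C + 1) p * ‖T^[j] l p - T^[j] m p‖ₑ) := by
          rw [lintegral_const_mul' _ _ ENNReal.coe_ne_top]
          gcongr
          exact lintegral_expWeight_mul_rect_le hk0
            ((Lp.aestronglyMeasurable _).sub (Lp.aestronglyMeasurable _)).enorm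
      _ ≤ 2⁻¹ * (2⁻¹ ^ j * ∫⁻ p in unitSq, ‖l p - m p‖ₑ) := by
          rw [← mul_assoc]
          gcongr
          exact mul_ofReal_inv_le_half C
      _ = _ := by rw [pow_succ']; ring

/-- The `L²` distance after one more step is controlled by the `L¹` distance, because the Volterra
bound is pointwise; so the geometric decay in `L¹` carries over to `L²`. -/
theorem edist_iterate_le {n : ℕ} {C : ℝ≥0} {T : L2Sq n → L2Sq n}
    (hT : VolterraLipschitz C T) (l m : L2Sq n) (j : ℕ) :
    edist (T^[j + 1] l) (T^[j + 1] m) ≤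
      C * gronwallConst C * 2⁻¹ ^ j * edist l m := by
  have hk0 : (0 : ℝ) < 2 * C + 1 := by positivity
  have h1 : ∫⁻ p in unitSq, ‖l p - m p‖ₑ ≤ ‖l - m‖ₑ := by
    refine le_trans (le_of_eq ?_) (lintegral_enorm_le_enorm (l - m))
    refine lintegral_congr_ae ?_
    filter_upwards [Lp.coeFn_sub l m] with p hp
    rw [hp, Pi.sub_apply]
  have h2 : ∫⁻ p in unitSq, ‖T^[j] l p - T^[j] m p‖ₑ ≤
      gronwallConst C * 2⁻¹ ^ j * ‖l - m‖ₑ := by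
    refine (lintegral_le_exp_mul hk0.le _).trans ?_
    rw [mul_assoc]
    gcongr
    · rw [← two_mul_ofReal_exp]
      exact le_mul_of_one_le_right' one_le_two
    · refine (hT.lintegral_expWeight_iterate_le l m j).trans ?_
      gcongr
  rw [edist_eq_enorm_sub, edist_eq_enorm_sub]
  have h3 : ‖T^[j + 1] l - T^[j + 1] m‖ₑ ≤
      ‖(0 : L2Sq n)‖ₑ + C * (gronwallConst C * 2⁻¹ ^ j * ‖l - m‖ₑ) := by
    refine enorm_le_of_ae_enorm_le_add ?_
    filter_upwards [hT (T^[j] l) (T^[j] m), Lp.coeFn_sub (T^[j + 1] l) (T^[j + 1] m),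
      ae_restrict_mem measurableSet_unitSq] with p hp h4 hpQ
    rw [h4, Pi.sub_apply, Function.iterate_succ_apply', Function.iterate_succ_apply']
    refine hp.trans (le_add_left ?_)
    gcongr
    exact (lintegral_rect_le hpQ _).trans h2
  refine h3.trans (le_of_eq ?_)
  rw [enorm_zero, zero_add]
  ring

/-- The equation `l + T l = v` with a Volterra–Lipschitz map `T` is solvable for every `v`, since
an iterate of `l ↦ v - T l` is a contraction. -/
theorem exists_add_eq {n : ℕ} {C : ℝ≥0} {T : L2Sq n → L2Sq n}
    (hT : VolterraLipschitz C T) (v : L2Sq n) : ∃ l, l + T l = v := by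
  have hU : VolterraLipschitz C (fun l => v - T l) := by
    intro l m
    filter_upwards [hT l m, Lp.coeFn_sub v (T l), Lp.coeFn_sub v (T m)] with p hp h1 h2
    rw [h1, h2, Pi.sub_apply, Pi.sub_apply, sub_sub_sub_cancel_left, ← enorm_neg, neg_sub]
    exact hp
  obtain ⟨j, hj⟩ : ∃ j : ℕ, C * gronwallConst C * 2⁻¹ ^ j < (1 : ℝ≥0) := by
    have : Tendsto (fun j : ℕ => C * gronwallConst C * (2⁻¹ : ℝ≥0) ^ j) atTop
        (𝓝 (C * gronwallConst C * 0)) :=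
      Tendsto.const_mul _ (NNReal.tendsto_pow_atTop_nhds_zero_of_lt_one two_inv_lt_one)
    rw [mul_zero] at this
    exact (this.eventually (gt_mem_nhds zero_lt_one)).exists
  have hc : ContractingWith (C * gronwallConst C * 2⁻¹ ^ j) (fun l => v - T l)^[j + 1] := by
    refine ⟨hj, fun l m => (hU.edist_iterate_le l m j).trans (le_of_eq ?_)⟩
    push_cast
    simp
  exact ⟨_, eq_sub_iff_add_eq.1 hc.isFixedPt_fixedPoint_iterate.eq.symm⟩

/-- If `K` is linear and Volterra–Lipschitz, then `id + K` is an isomorphism. -/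
theorem exists_equiv_id_add {n : ℕ} {C : ℝ≥0} {K : L2Sq n →L[ℝ] L2Sq n}
    (hK : VolterraLipschitz C K) :
    ∃ e : L2Sq n ≃L[ℝ] L2Sq n, (e : L2Sq n →L[ℝ] L2Sq n) = ContinuousLinearMap.id ℝ _ + K := by
  refine ⟨ContinuousLinearEquiv.ofBijective (ContinuousLinearMap.id ℝ _ + K) ?_ ?_, ?_⟩
  · rw [LinearMap.ker_eq_bot']
    intro l hl
    have h := enorm_sub_le_of_add_eq (hK l 0) (v := 0) (w := 0) hl (by simp)
    simpa using h
  · rw [LinearMap.range_eq_top]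
    exact fun v => hK.exists_add_eq v
  · ext1 l; rfl

end VolterraLipschitz

/-! ### Integral and multiplication operators on `L²(Q, ℝⁿ)` -/

/-- The bounded operator of `L²(Q, ℝⁿ)` given by a map `F` on representatives that is linear up to
null sets and bounded by `C` in the `L²` norm. -/
noncomputable def l2Operator {n : ℕ} (F : L2Sq n → ℝ × ℝ → Vec n) (C : ℝ≥0)
    (hm : ∀ l, AEStronglyMeasurable (F l) (volume.restrict unitSq))
    (hadd : ∀ l m, F (l + m) =ᵐ[volume.restrict unitSq] F l + F m)
    (hsmul : ∀ (c : ℝ) l, F (c • l) =ᵐ[volume.restrict unitSq] c • F l)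
    (hC : ∀ l, eLpNorm (F l) 2 (volume.restrict unitSq) ≤ C * ‖l‖ₑ) : L2Sq n →L[ℝ] L2Sq n :=
  have hF : ∀ l, MemLp (F l) 2 (volume.restrict unitSq) := fun l =>
    ⟨hm l, (hC l).trans_lt (ENNReal.mul_lt_top ENNReal.coe_lt_top enorm_lt_top)⟩
  LinearMap.mkContinuous
    { toFun := fun l => (hF l).toLp (F l)
      map_add' := fun l m => by
        rw [← MemLp.toLp_add]
        exact MemLp.toLp_congr _ _ (hadd l m)
      map_smul' := fun c l => by
        rw [RingHom.id_apply, ← MemLp.toLp_const_smul]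
        exact MemLp.toLp_congr _ _ (hsmul c l) } C fun l => by
      have h : ‖(hF l).toLp (F l)‖ₑ ≤ C * ‖l‖ₑ := (Lp.enorm_toLp (hF l)).trans_le (hC l)
      rw [← ofReal_norm, ← ofReal_norm, ← ENNReal.ofReal_coe_nnreal,
        ← ENNReal.ofReal_mul C.coe_nonneg,
        ENNReal.ofReal_le_ofReal_iff (by positivity)] at h
      exact h

theorem l2Operator_ae_eq {n : ℕ} {F : L2Sq n → ℝ × ℝ → Vec n} {C : ℝ≥0}
    (hm : ∀ l, AEStronglyMeasurable (F l) (volume.restrict unitSq))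
    (hadd : ∀ l m, F (l + m) =ᵐ[volume.restrict unitSq] F l + F m)
    (hsmul : ∀ (c : ℝ) l, F (c • l) =ᵐ[volume.restrict unitSq] c • F l)
    (hC : ∀ l, eLpNorm (F l) 2 (volume.restrict unitSq) ≤ C * ‖l‖ₑ) (l : L2Sq n) :
    l2Operator F C hm hadd hsmul hC l =ᵐ[volume.restrict unitSq] F l :=
  MemLp.coeFn_toLp (⟨hm l, (hC l).trans_lt (ENNReal.mul_lt_top ENNReal.coe_lt_top enorm_lt_top)⟩ :
    MemLp (F l) 2 (volume.restrict unitSq))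

theorem integrableOn_coe {n : ℕ} (l : L2Sq n) : IntegrableOn l unitSq :=
  (Lp.memLp l).integrable one_le_two

/-- The double integral `∫₀ˣ∫₀ʸ l`. -/
noncomputable def prim {F : Type*} [NormedAddCommGroup F] [NormedSpace ℝ F]
    (l : ℝ × ℝ → F) (p : ℝ × ℝ) : F := ∫ q in rect p, l q

theorem enorm_prim_le {n : ℕ} (l : ℝ × ℝ → Vec n) (p : ℝ × ℝ) :
    ‖prim l p‖ₑ ≤ ∫⁻ q in rect p, ‖l q‖ₑ :=
  enorm_integral_le_lintegral_enorm _

theorem enorm_prim_le_enorm {n : ℕ} (l : L2Sq n) {p : ℝ × ℝ} (hp : p ∈ unitSq) :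
    ‖prim l p‖ₑ ≤ ‖l‖ₑ :=
  (enorm_prim_le l p).trans ((lintegral_rect_le hp _).trans (lintegral_enorm_le_enorm l))

theorem norm_prim_le_norm {n : ℕ} (l : L2Sq n) {p : ℝ × ℝ} (hp : p ∈ unitSq) :
    ‖prim l p‖ ≤ ‖l‖ :=
  enorm_le_iff_norm_le.1 (enorm_prim_le_enorm l hp)

theorem prim_congr_ae {n : ℕ} {l m : ℝ × ℝ → Vec n} (h : l =ᵐ[volume.restrict unitSq] m)
    {p : ℝ × ℝ} (hp : p ∈ unitSq) : prim l p = prim m p :=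
  integral_congr_ae (ae_restrict_rect hp h)

theorem prim_add {n : ℕ} (l m : L2Sq n) {p : ℝ × ℝ} (hp : p ∈ unitSq) :
    prim (l + m : L2Sq n) p = prim l p + prim m p := by
  rw [prim_congr_ae (Lp.coeFn_add l m) hp]
  exact integral_add (integrableOn_rect (integrableOn_coe l) hp)
    (integrableOn_rect (integrableOn_coe m) hp)

theorem prim_sub {n : ℕ} (l m : L2Sq n) {p : ℝ × ℝ} (hp : p ∈ unitSq) :
    prim (l - m : L2Sq n) p = prim l p - prim m p := by
  rw [prim_congr_ae (Lp.coeFn_sub l m) hp]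
  exact integral_sub (integrableOn_rect (integrableOn_coe l) hp)
    (integrableOn_rect (integrableOn_coe m) hp)

theorem prim_smul {n : ℕ} (c : ℝ) (l : L2Sq n) {p : ℝ × ℝ} (hp : p ∈ unitSq) :
    prim (c • l : L2Sq n) p = c • prim l p := by
  rw [prim_congr_ae (Lp.coeFn_smul c l) hp]
  exact integral_smul c _

theorem stronglyMeasurable_prim {F : Type*} [NormedAddCommGroup F] [NormedSpace ℝ F]
    {l : ℝ × ℝ → F} (hl : StronglyMeasurable l) :
    StronglyMeasurable (prim l) := by
  have hs : MeasurableSet {w : (ℝ × ℝ) × ℝ × ℝ | w.2 ∈ rect w.1} := by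
    simp only [rect, mem_prod, mem_Icc]
    measurability
  have h : StronglyMeasurable (fun w : (ℝ × ℝ) × ℝ × ℝ =>
      {w : (ℝ × ℝ) × ℝ × ℝ | w.2 ∈ rect w.1}.indicator (fun w => l w.2) w) :=
    StronglyMeasurable.indicator (hl.comp_measurable measurable_snd) hs
  have h2 := h.integral_prod_right' (ν := volume)
  convert h2 using 1
  funext p
  change ∫ q in Icc 0 p.1 ×ˢ Icc 0 p.2, l q = _
  rw [← integral_indicator (measurableSet_Icc.prod measurableSet_Icc)]
  rfl

/-- The operator `l ↦ ∫₀ˣ∫₀ʸ l`. -/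
noncomputable def primL (n : ℕ) : L2Sq n →L[ℝ] L2Sq n :=
  l2Operator (fun l => prim l) 1
    (fun l => (stronglyMeasurable_prim (Lp.stronglyMeasurable l)).aestronglyMeasurable)
    (fun l m => by
      filter_upwards [ae_restrict_mem measurableSet_unitSq] with p hp using prim_add l m hp)
    (fun c l => by
      filter_upwards [ae_restrict_mem measurableSet_unitSq] with p hp using prim_smul c l hp)
    fun l => by
      have h : ∀ᵐ p ∂volume.restrict unitSq, ‖prim l p‖ ≤ ‖l‖ := by
        filter_upwards [ae_restrict_mem measurableSet_unitSq] with p hp using norm_prim_le_norm l hp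
      refine (eLpNorm_le_of_ae_bound h).trans (le_of_eq ?_)
      simp

theorem primL_ae_eq {n : ℕ} (l : L2Sq n) : primL n l =ᵐ[volume.restrict unitSq] prim l :=
  l2Operator_ae_eq _ _ _ _ l

/-- Multiplication by a bounded measurable matrix function. -/
noncomputable def multOp {n : ℕ} (D : ℝ × ℝ → Vec n →L[ℝ] Vec n) (C : ℝ≥0)
    (hD : AEStronglyMeasurable D (volume.restrict unitSq))
    (hC : ∀ᵐ p ∂volume.restrict unitSq, ‖D p‖ₑ ≤ C) : L2Sq n →L[ℝ] L2Sq n :=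
  l2Operator (fun l p => D p (l p)) C
    (fun l => (isBoundedBilinearMap_apply (𝕜 := ℝ) (E := Vec n)
      (F := Vec n)).continuous.comp_aestronglyMeasurable (hD.prodMk (Lp.aestronglyMeasurable l)))
    (fun l m => by
      filter_upwards [Lp.coeFn_add l m] with p hp
      rw [hp, Pi.add_apply, map_add, Pi.add_apply])
    (fun c l => by
      filter_upwards [Lp.coeFn_smul c l] with p hp
      rw [hp, Pi.smul_apply, map_smul, Pi.smul_apply])
    fun l => by
      have h : ∀ᵐ p ∂volume.restrict unitSq, ‖D p (l p)‖ₑ ≤ C * ‖l p‖ₑ := by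
        filter_upwards [hC] with p hp
        exact ((D p).le_opENorm _).trans (by gcongr)
      rw [Lp.enorm_def]
      exact eLpNorm_le_nnreal_smul_eLpNorm_of_ae_le_mul' h 2

theorem multOp_ae_eq {n : ℕ} {D : ℝ × ℝ → Vec n →L[ℝ] Vec n} {C : ℝ≥0}
    (hD : AEStronglyMeasurable D (volume.restrict unitSq))
    (hC : ∀ᵐ p ∂volume.restrict unitSq, ‖D p‖ₑ ≤ C) (l : L2Sq n) :
    multOp D C hD hC l =ᵐ[volume.restrict unitSq] fun p => D p (l p) :=
  l2Operator_ae_eq _ _ _ _ l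

/-- The partial integral `∫₀ʸ l(x, t) dt`. -/
noncomputable def sliceInt {F : Type*} [NormedAddCommGroup F] [NormedSpace ℝ F]
    (l : ℝ × ℝ → F) (p : ℝ × ℝ) : F :=
  ∫ t in Icc 0 p.2, l (p.1, t)

theorem stronglyMeasurable_sliceInt {F : Type*} [NormedAddCommGroup F] [NormedSpace ℝ F]
    {l : ℝ × ℝ → F} (hl : StronglyMeasurable l) :
    StronglyMeasurable (sliceInt l) := by
  have hs : MeasurableSet {w : (ℝ × ℝ) × ℝ | w.2 ∈ Icc 0 w.1.2} := by
    simp only [mem_Icc]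
    measurability
  have h : StronglyMeasurable (fun w : (ℝ × ℝ) × ℝ =>
      {w : (ℝ × ℝ) × ℝ | w.2 ∈ Icc 0 w.1.2}.indicator (fun w => l (w.1.1, w.2)) w) :=
    StronglyMeasurable.indicator (hl.comp_measurable (by fun_prop)) hs
  have h2 := h.integral_prod_right' (ν := volume)
  convert h2 using 1
  funext p
  change ∫ t in Icc 0 p.2, l (p.1, t) = _
  rw [← integral_indicator measurableSet_Icc]
  rfl

theorem enorm_sliceInt_le {n : ℕ} (l : ℝ × ℝ → Vec n) {p : ℝ × ℝ} {y : ℝ} (hy : p.2 ≤ y) :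
    ‖sliceInt l p‖ₑ ≤ ∫⁻ t in Icc 0 y, ‖l (p.1, t)‖ₑ :=
  (enorm_integral_le_lintegral_enorm _).trans (lintegral_mono_set (Icc_subset_Icc_right hy))

/-- A property that holds almost everywhere on the square holds almost everywhere on almost every
vertical section. -/
theorem ae_ae_section {P : ℝ × ℝ → Prop} (h : ∀ᵐ q ∂volume.restrict unitSq, P q) :
    ∀ᵐ p ∂volume.restrict unitSq, ∀ᵐ t ∂volume.restrict (Icc (0 : ℝ) 1), P (p.1, t) := by
  rw [restrict_unitSq_eq_prod] at h ⊢
  exact Measure.quasiMeasurePreserving_fst.ae (Measure.ae_ae_of_ae_prod h)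

theorem ae_integrableOn_section {n : ℕ} {l : ℝ × ℝ → Vec n} (h : IntegrableOn l unitSq) :
    ∀ᵐ p ∂volume.restrict unitSq, IntegrableOn (fun t => l (p.1, t)) (Icc 0 1) := by
  rw [IntegrableOn, restrict_unitSq_eq_prod] at h
  rw [restrict_unitSq_eq_prod]
  exact Measure.quasiMeasurePreserving_fst.ae h.prod_right_ae

theorem sliceInt_congr_ae {n : ℕ} {l m : ℝ × ℝ → Vec n} (h : l =ᵐ[volume.restrict unitSq] m) :
    sliceInt l =ᵐ[volume.restrict unitSq] sliceInt m := by
  filter_upwards [ae_ae_section h, ae_restrict_mem measurableSet_unitSq] with p h1 hp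
  exact integral_congr_ae (ae_restrict_of_ae_restrict_of_subset (Icc_subset_Icc_right hp.2.2) h1)

/-- By Jensen's inequality on the vertical sections of the square. -/
theorem eLpNorm_sliceInt_le {n : ℕ} {l : ℝ × ℝ → Vec n} (hl : StronglyMeasurable l) :
    eLpNorm (sliceInt l) 2 (volume.restrict unitSq) ≤ eLpNorm l 2 (volume.restrict unitSq) := by
  have hm : Measurable fun p : ℝ × ℝ => ‖l p‖ₑ ^ ((2 : ℝ≥0) : ℝ) := hl.enorm.pow_const _
  have e {μ : Measure (ℝ × ℝ)} (f : ℝ × ℝ → Vec n) :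
      eLpNorm f 2 μ ^ ((2 : ℝ≥0) : ℝ) = ∫⁻ p, ‖f p‖ₑ ^ ((2 : ℝ≥0) : ℝ) ∂μ :=
    eLpNorm_nnreal_pow_eq_lintegral two_ne_zero
  have key : ∀ p ∈ unitSq, ‖sliceInt l p‖ₑ ^ ((2 : ℝ≥0) : ℝ) ≤
      ∫⁻ t in Icc (0 : ℝ) 1, ‖l (p.1, t)‖ₑ ^ ((2 : ℝ≥0) : ℝ) := by
    intro p hp
    have hs : AEStronglyMeasurable (fun t => l (p.1, t)) (volume.restrict (Icc (0 : ℝ) 1)) :=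
      (hl.comp_measurable (by fun_prop)).aestronglyMeasurable
    rw [← eLpNorm_nnreal_pow_eq_lintegral two_ne_zero]
    refine ENNReal.rpow_le_rpow ?_ (NNReal.coe_nonneg 2)
    refine (enorm_sliceInt_le l hp.2.2).trans ?_
    rw [← eLpNorm_one_eq_lintegral_enorm]
    exact eLpNorm_le_eLpNorm_of_exponent_le one_le_two hs
  rw [← ENNReal.rpow_le_rpow_iff (z := ((2 : ℝ≥0) : ℝ)) (by norm_num), e, e]
  refine (setLIntegral_mono' measurableSet_unitSq key).trans (le_of_eq ?_)
  rw [restrict_unitSq_eq_prod, lintegral_prod _ hm.aemeasurable,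
    lintegral_prod (fun p : ℝ × ℝ => ∫⁻ t in Icc (0 : ℝ) 1, ‖l (p.1, t)‖ₑ ^ ((2 : ℝ≥0) : ℝ))]
  · simp only [lintegral_const, measure_univ, mul_one]
  · exact (hm.lintegral_prod_right'.comp measurable_fst).aemeasurable

theorem lintegral_rect_sliceInt_le {n : ℕ} {l : ℝ × ℝ → Vec n} (hl : StronglyMeasurable l)
    {p : ℝ × ℝ} (hp : p ∈ unitSq) :
    ∫⁻ q in rect p, ‖sliceInt l q‖ₑ ≤ ∫⁻ q in rect p, ‖l q‖ₑ := by
  have hm : Measurable fun p : ℝ × ℝ => ‖l p‖ₑ := hl.enorm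
  have h1 : ∫⁻ q in rect p, ‖sliceInt l q‖ₑ ≤
      ∫⁻ q in rect p, ∫⁻ t in Icc 0 p.2, ‖l (q.1, t)‖ₑ :=
    setLIntegral_mono' (measurableSet_Icc.prod measurableSet_Icc)
      fun q hq => enorm_sliceInt_le l hq.2.2
  have h2 : volume (Icc 0 p.2) ≤ 1 := by
    rw [Real.volume_Icc, ← ENNReal.ofReal_one]
    exact ENNReal.ofReal_le_ofReal (by linarith [hp.2.2])
  refine h1.trans ?_
  rw [rect, Measure.volume_eq_prod, ← Measure.prod_restrict, lintegral_prod _ hm.aemeasurable,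
    lintegral_prod (fun q : ℝ × ℝ => ∫⁻ t in Icc (0 : ℝ) p.2, ‖l (q.1, t)‖ₑ)
      (hm.lintegral_prod_right'.comp measurable_fst).aemeasurable]
  refine lintegral_mono fun s => ?_
  simp only [lintegral_const, Measure.restrict_apply_univ]
  exact (mul_le_mul_right h2 _).trans_eq (mul_one _)

/-- The operator `l ↦ ∫₀ʸ l(x, t) dt`. -/
noncomputable def sliceL (n : ℕ) : L2Sq n →L[ℝ] L2Sq n :=
  l2Operator (fun l => sliceInt l) 1
    (fun l => (stronglyMeasurable_sliceInt (Lp.stronglyMeasurable l)).aestronglyMeasurable)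
    (fun l m => by
      filter_upwards [sliceInt_congr_ae (Lp.coeFn_add l m), ae_integrableOn_section (integrableOn_coe l),
        ae_integrableOn_section (integrableOn_coe m), ae_restrict_mem measurableSet_unitSq] with p h hl hm hp
      rw [h]
      exact integral_add (hl.mono_set (Icc_subset_Icc_right hp.2.2))
        (hm.mono_set (Icc_subset_Icc_right hp.2.2)))
    (fun c l => by
      filter_upwards [sliceInt_congr_ae (Lp.coeFn_smul c l)] with p h
      rw [h]
      exact integral_smul c _)
    fun l => by
      rw [ENNReal.coe_one, one_mul, Lp.enorm_def]
      exact eLpNorm_sliceInt_le (Lp.stronglyMeasurable l)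

theorem sliceL_ae_eq {n : ℕ} (l : L2Sq n) : sliceL n l =ᵐ[volume.restrict unitSq] sliceInt l :=
  l2Operator_ae_eq _ _ _ _ l

/-- Integrating a partial integral of `|l|` once more over the rectangle gains nothing worse than
the double integral of `|l|`. -/
theorem lintegral_rect_sliceL_le {n : ℕ} (l : L2Sq n) {p : ℝ × ℝ} (hp : p ∈ unitSq) :
    ∫⁻ q in rect p, ‖sliceL n l q‖ₑ ≤ ∫⁻ q in rect p, ‖l q‖ₑ := by
  refine le_of_eq_of_le (lintegral_congr_ae (ae_restrict_rect hp ?_))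
    (lintegral_rect_sliceInt_le (Lp.stronglyMeasurable l) hp)
  filter_upwards [sliceL_ae_eq l] with q hq
  rw [hq]

theorem measurePreserving_swap_unitSq :
    MeasurePreserving Prod.swap (volume.restrict unitSq) (volume.restrict unitSq) := by
  rw [restrict_unitSq_eq_prod]
  exact Measure.measurePreserving_swap

/-- The operator `l ↦ l(y, x)`. -/
noncomputable def swapL (n : ℕ) : L2Sq n →L[ℝ] L2Sq n :=
  (Lp.compMeasurePreservingₗᵢ ℝ Prod.swap measurePreserving_swap_unitSq).toContinuousLinearMap

theorem swapL_ae_eq {n : ℕ} (l : L2Sq n) :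
    swapL n l =ᵐ[volume.restrict unitSq] fun p => l p.swap :=
  Lp.coeFn_compMeasurePreserving l measurePreserving_swap_unitSq

theorem measurePreserving_swap_rect (p : ℝ × ℝ) :
    MeasurePreserving Prod.swap (volume.restrict (rect p)) (volume.restrict (rect p.swap)) := by
  rw [rect, rect, Measure.volume_eq_prod, ← Measure.prod_restrict, ← Measure.prod_restrict]
  exact Measure.measurePreserving_swap

theorem lintegral_rect_swapL {n : ℕ} (l : L2Sq n) {p : ℝ × ℝ} (hp : p ∈ unitSq) :
    ∫⁻ q in rect p, ‖swapL n l q‖ₑ = ∫⁻ q in rect p.swap, ‖l q‖ₑ := by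
  rw [← (measurePreserving_swap_rect p).lintegral_comp_emb
    MeasurableEquiv.prodComm.measurableEmbedding]
  refine lintegral_congr_ae (ae_restrict_rect hp ?_)
  filter_upwards [swapL_ae_eq l] with q hq
  rw [hq]

/-- The operator `l ↦ ∫₀ˣ l(s, y) ds`. -/
noncomputable def sliceL' (n : ℕ) : L2Sq n →L[ℝ] L2Sq n := swapL n ∘L sliceL n ∘L swapL n

theorem lintegral_rect_sliceL'_le {n : ℕ} (l : L2Sq n) {p : ℝ × ℝ} (hp : p ∈ unitSq) :
    ∫⁻ q in rect p, ‖sliceL' n l q‖ₑ ≤ ∫⁻ q in rect p, ‖l q‖ₑ := by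
  have hp' : p.swap ∈ unitSq := ⟨hp.2, hp.1⟩
  calc _ = ∫⁻ q in rect p.swap, ‖sliceL n (swapL n l) q‖ₑ := lintegral_rect_swapL _ hp
    _ ≤ ∫⁻ q in rect p.swap, ‖swapL n l q‖ₑ := lintegral_rect_sliceL_le _ hp'
    _ = _ := by rw [lintegral_rect_swapL l hp', Prod.swap_swap]

/-! ### Pointwise bounds for the integro-differential operator -/

theorem lintegral_rect_rect_le (u : ℝ × ℝ → ℝ≥0∞) {p : ℝ × ℝ} (hp : p ∈ unitSq) :
    ∫⁻ q in rect p, ∫⁻ r in rect q, u r ≤ ∫⁻ r in rect p, u r := by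
  have h1 : volume (rect p) ≤ 1 := by
    refine (measure_mono (rect_subset_unitSq hp)).trans (le_of_eq ?_)
    rw [← Measure.restrict_apply_univ]
    exact measure_univ
  calc _ ≤ ∫⁻ _ in rect p, ∫⁻ r in rect p, u r :=
        setLIntegral_mono' (measurableSet_Icc.prod measurableSet_Icc) fun q hq =>
          lintegral_mono_set (prod_mono (Icc_subset_Icc_right hq.1.2) (Icc_subset_Icc_right hq.2.2))
    _ ≤ _ := by
      rw [lintegral_const, Measure.restrict_apply_univ]
      exact (mul_le_mul_right h1 _).trans_eq (mul_one _)

/-- The map `l ↦ N₁ l + ∫₀ˣ∫₀ʸ (N₂ l + L₁ ∫₀ʸ l + L₂ ∫₀ˣ l)`; with superposition operators `N₁`,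
`N₂` and multiplication operators `L₁`, `L₂` this is the lower order part of the equation in terms
of `l = z_{xy}`. -/
noncomputable def systemOp {n : ℕ} (N₁ N₂ : L2Sq n → L2Sq n) (L₁ L₂ : L2Sq n →L[ℝ] L2Sq n)
    (l : L2Sq n) : L2Sq n :=
  N₁ l + primL n (N₂ l + (L₁ (sliceL n l) + L₂ (sliceL' n l)))

/-- All terms of the operator are dominated by the double integral `∫₀ˣ∫₀ʸ |d|` alone: the terms
with the first derivatives occur only under a double integral. -/
theorem enorm_add_primL_le {n : ℕ} {a c d : L2Sq n} {C B : ℝ≥0} {β : ℝ × ℝ → ℝ≥0∞}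
    {L₁ L₂ : L2Sq n →L[ℝ] L2Sq n} (hβ : AEMeasurable β (volume.restrict unitSq))
    (ha : ∀ᵐ p ∂volume.restrict unitSq, ‖a p‖ₑ ≤ C * (∫⁻ q in rect p, ‖d q‖ₑ) + β p)
    (hc : ∀ᵐ p ∂volume.restrict unitSq, ‖c p‖ₑ ≤ C * (∫⁻ q in rect p, ‖d q‖ₑ) + β p)
    (h₁ : ∀ m : L2Sq n, ∀ᵐ p ∂volume.restrict unitSq, ‖L₁ m p‖ₑ ≤ B * ‖m p‖ₑ)
    (h₂ : ∀ m : L2Sq n, ∀ᵐ p ∂volume.restrict unitSq, ‖L₂ m p‖ₑ ≤ B * ‖m p‖ₑ) :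
    ∀ᵐ p ∂volume.restrict unitSq,
      ‖(a + primL n (c + (L₁ (sliceL n d) + L₂ (sliceL' n d)))) p‖ₑ ≤
        (2 * C + 2 * B : ℝ≥0) * (∫⁻ q in rect p, ‖d q‖ₑ) + (β p + ∫⁻ q in unitSq, β q) := by
  set e := c + (L₁ (sliceL n d) + L₂ (sliceL' n d)) with he
  have hae : ∀ᵐ q ∂volume.restrict unitSq, ‖e q‖ₑ ≤
      (β q + (B * ‖sliceL n d q‖ₑ + B * ‖sliceL' n d q‖ₑ)) +
        C * ∫⁻ r in rect q, ‖d r‖ₑ := by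
    filter_upwards [hc, h₁ (sliceL n d), h₂ (sliceL' n d),
      Lp.coeFn_add c (L₁ (sliceL n d) + L₂ (sliceL' n d)),
      Lp.coeFn_add (L₁ (sliceL n d)) (L₂ (sliceL' n d))] with q h3 h4 h5 h6 h7
    rw [he, h6, Pi.add_apply, h7, Pi.add_apply]
    calc _ ≤ ‖c q‖ₑ + (‖L₁ (sliceL n d) q‖ₑ + ‖L₂ (sliceL' n d) q‖ₑ) :=
          (enorm_add_le _ _).trans (by gcongr; exact enorm_add_le _ _)
      _ ≤ (C * (∫⁻ r in rect q, ‖d r‖ₑ) + β q) +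
          (B * ‖sliceL n d q‖ₑ + B * ‖sliceL' n d q‖ₑ) := by gcongr
      _ = _ := by ring
  have hint : ∀ p ∈ unitSq, ∫⁻ q in rect p, ‖e q‖ₑ ≤
      (∫⁻ q in unitSq, β q) + (C + 2 * B) * ∫⁻ q in rect p, ‖d q‖ₑ := by
    intro p hp
    have hle : volume.restrict (rect p) ≤ volume.restrict unitSq :=
      Measure.restrict_mono (rect_subset_unitSq hp) le_rfl
    have m0 := hβ.mono_measure hle
    have m1 := ((aemeasurable_enorm_coe (sliceL n d)).mono_measure hle).const_mul (B : ℝ≥0∞)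
    have m2 := ((aemeasurable_enorm_coe (sliceL' n d)).mono_measure hle).const_mul (B : ℝ≥0∞)
    have m3 : AEMeasurable (fun q => β q + (B * ‖sliceL n d q‖ₑ + B * ‖sliceL' n d q‖ₑ))
        (volume.restrict (rect p)) := m0.add (m1.add m2)
    refine (lintegral_mono_ae (ae_restrict_rect hp hae)).trans ?_
    rw [lintegral_add_left' m3, lintegral_add_left' m0, lintegral_add_left' m1,
      lintegral_const_mul' _ _ ENNReal.coe_ne_top, lintegral_const_mul' _ _ ENNReal.coe_ne_top,
      lintegral_const_mul' _ _ ENNReal.coe_ne_top]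
    calc _ ≤ (∫⁻ q in unitSq, β q) + (B * (∫⁻ q in rect p, ‖d q‖ₑ) +
          B * ∫⁻ q in rect p, ‖d q‖ₑ) + C * ∫⁻ q in rect p, ‖d q‖ₑ := by
          gcongr ?_ + (_ * ?_ + _ * ?_) + _ * ?_
          · exact lintegral_rect_le hp _
          · exact lintegral_rect_sliceL_le d hp
          · exact lintegral_rect_sliceL'_le d hp
          · exact lintegral_rect_rect_le _ hp
      _ = _ := by ring
  filter_upwards [ha, Lp.coeFn_add a (primL n e), primL_ae_eq e,
    ae_restrict_mem measurableSet_unitSq] with p h3 h4 h5 hp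
  rw [h4, Pi.add_apply, h5]
  calc _ ≤ ‖a p‖ₑ + ‖prim e p‖ₑ := enorm_add_le _ _
    _ ≤ (C * (∫⁻ q in rect p, ‖d q‖ₑ) + β p) +
        ((∫⁻ q in unitSq, β q) + (C + 2 * B) * ∫⁻ q in rect p, ‖d q‖ₑ) := by
        gcongr
        exact (enorm_prim_le _ _).trans (hint p hp)
    _ = _ := by push_cast; ring

theorem VolterraLipschitz.systemOp {n : ℕ} {N₁ N₂ : L2Sq n → L2Sq n}
    {L₁ L₂ : L2Sq n →L[ℝ] L2Sq n} {C B : ℝ≥0} (hN₁ : VolterraLipschitz C N₁)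
    (hN₂ : VolterraLipschitz C N₂)
    (h₁ : ∀ m : L2Sq n, ∀ᵐ p ∂volume.restrict unitSq, ‖L₁ m p‖ₑ ≤ B * ‖m p‖ₑ)
    (h₂ : ∀ m : L2Sq n, ∀ᵐ p ∂volume.restrict unitSq, ‖L₂ m p‖ₑ ≤ B * ‖m p‖ₑ) :
    VolterraLipschitz (2 * C + 2 * B) (systemOp N₁ N₂ L₁ L₂) := by
  intro l m
  have key : ∀ {N : L2Sq n → L2Sq n}, VolterraLipschitz C N →
      ∀ᵐ p ∂volume.restrict unitSq,
        ‖(N l - N m) p‖ₑ ≤ C * (∫⁻ q in rect p, ‖(l - m) q‖ₑ) + (0 : ℝ × ℝ → ℝ≥0∞) p := by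
    intro N hN
    filter_upwards [hN l m, Lp.coeFn_sub (N l) (N m), ae_restrict_mem measurableSet_unitSq]
      with p h1 h2 hp
    rw [h2, lintegral_rect_sub l m hp]
    simpa using h1
  have h := enorm_add_primL_le (β := 0) aemeasurable_const (key hN₁) (key hN₂) h₁ h₂
  have e : (N₁ l - N₁ m) + primL n ((N₂ l - N₂ m) +
      (L₁ (sliceL n (l - m)) + L₂ (sliceL' n (l - m)))) =
      TwoDSystem.systemOp N₁ N₂ L₁ L₂ l - TwoDSystem.systemOp N₁ N₂ L₁ L₂ m := by
    simp only [TwoDSystem.systemOp, map_add, map_sub]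
    abel
  rw [e] at h
  filter_upwards [h, Lp.coeFn_sub (TwoDSystem.systemOp N₁ N₂ L₁ L₂ l)
    (TwoDSystem.systemOp N₁ N₂ L₁ L₂ m), ae_restrict_mem measurableSet_unitSq] with p h3 h4 hp
  rw [h4, lintegral_rect_sub l m hp] at h3
  simpa using h3

/-- A priori bound: linear growth alone bounds the function `z = ∫₀ˣ∫₀ʸ l` of a solution
uniformly in terms of the right-hand side. -/
theorem enorm_prim_le_of_add_systemOp_eq {n : ℕ} {N₁ N₂ : L2Sq n → L2Sq n}
    {L₁ L₂ : L2Sq n →L[ℝ] L2Sq n} {B : ℝ≥0} {β : ℝ × ℝ → ℝ≥0∞} {l v : L2Sq n}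
    (hβ : AEMeasurable β (volume.restrict unitSq))
    (hN₁ : ∀ᵐ p ∂volume.restrict unitSq, ‖N₁ l p‖ₑ ≤ B * (∫⁻ q in rect p, ‖l q‖ₑ) + β p)
    (hN₂ : ∀ᵐ p ∂volume.restrict unitSq, ‖N₂ l p‖ₑ ≤ B * (∫⁻ q in rect p, ‖l q‖ₑ) + β p)
    (h₁ : ∀ m : L2Sq n, ∀ᵐ p ∂volume.restrict unitSq, ‖L₁ m p‖ₑ ≤ B * ‖m p‖ₑ)
    (h₂ : ∀ m : L2Sq n, ∀ᵐ p ∂volume.restrict unitSq, ‖L₂ m p‖ₑ ≤ B * ‖m p‖ₑ)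
    (hl : l + systemOp N₁ N₂ L₁ L₂ l = v) {p : ℝ × ℝ} (hp : p ∈ unitSq) :
    ‖prim l p‖ₑ ≤ gronwallConst (2 * B + 2 * B) * (‖v‖ₑ + 2 * ∫⁻ q in unitSq, β q) := by
  have h := enorm_add_primL_le hβ hN₁ hN₂ h₁ h₂
  have hg : ∀ᵐ p ∂volume.restrict unitSq, ‖l p‖ₑ ≤
      (‖v p‖ₑ + (β p + ∫⁻ q in unitSq, β q)) +
        (2 * B + 2 * B : ℝ≥0) * ∫⁻ q in rect p, ‖l q‖ₑ := by
    have e := Lp.coeFn_sub v (systemOp N₁ N₂ L₁ L₂ l)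
    rw [← eq_sub_iff_add_eq.2 hl] at e
    filter_upwards [h, e] with p h3 h4
    rw [h4, Pi.sub_apply]
    refine enorm_sub_le.trans ?_
    refine (add_le_add le_rfl h3).trans (le_of_eq ?_)
    ring
  refine (enorm_prim_le _ _).trans ((lintegral_rect_le hp _).trans ?_)
  have mg : AEMeasurable (fun p => ‖v p‖ₑ + (β p + ∫⁻ q in unitSq, β q))
      (volume.restrict unitSq) :=
    (aemeasurable_enorm_coe v).add (hβ.add aemeasurable_const)
  refine (lintegral_le_of_le_add_rect (aemeasurable_enorm_coe l) mg (lintegral_enorm_ne_top l)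
    hg).trans ?_
  gcongr
  rw [lintegral_add_left' (aemeasurable_enorm_coe v), lintegral_add_left' hβ, lintegral_const,
    measure_univ, mul_one, ← two_mul]
  gcongr
  exact lintegral_enorm_le_enorm v

/-! ### Superposition operators -/

/-- Superposition of a Carathéodory function with a measurable function is measurable. -/
theorem aestronglyMeasurable_superposition {α E F : Type*} [MeasurableSpace α] {μ : Measure α}
    [TopologicalSpace E] [NormedAddCommGroup F] {g : α → E → F}
    (hm : ∀ z, AEStronglyMeasurable (fun p => g p z) μ) (hc : ∀ᵐ p ∂μ, Continuous (g p))
    {w : α → E} (hw : AEStronglyMeasurable w μ) :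
    AEStronglyMeasurable (fun p => g p (w p)) μ := by
  classical
  set s := hw.stronglyMeasurable_mk.approx
  have hs : ∀ k, AEStronglyMeasurable (fun p => g p (s k p)) μ := by
    intro k
    have e : (fun p => g p (s k p)) = fun p => ∑ c ∈ (s k).range,
        ((s k) ⁻¹' {c}).indicator (fun p => g p c) p := by
      funext p
      rw [Finset.sum_eq_single_of_mem (s k p) (SimpleFunc.mem_range_self _ _)]
      · simp
      · intro c _ hc
        refine indicator_of_notMem ?_ _
        simpa using hc.symm
    rw [e]
    exact Finset.aestronglyMeasurable_fun_sum _ fun c _ =>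
      (hm c).indicator (SimpleFunc.measurableSet_fiber _ _)
  refine aestronglyMeasurable_of_tendsto_ae atTop hs ?_
  filter_upwards [hc, hw.ae_eq_mk] with p hp hwp
  rw [hwp]
  exact (hp.tendsto _).comp (hw.stronglyMeasurable_mk.tendsto_approx p)

theorem aestronglyMeasurable_prim {n : ℕ} (l : L2Sq n) :
    AEStronglyMeasurable (prim l) (volume.restrict unitSq) :=
  (stronglyMeasurable_prim (Lp.stronglyMeasurable l)).aestronglyMeasurable

/-- Carathéodory functions on `Q × ℝⁿ` of linear growth `|g(p,z)| ≤ B |z| + |b(p)|` with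
`b ∈ L²(Q)`. -/
structure Caratheodory {n : ℕ} (g : ℝ × ℝ → Vec n → Vec n) (B : ℝ≥0) (b : ℝ × ℝ → ℝ) : Prop where
  meas : ∀ z, AEStronglyMeasurable (fun p => g p z) (volume.restrict unitSq)
  cont : ∀ᵐ p ∂volume.restrict unitSq, Continuous (g p)
  memLp : MemLp b 2 (volume.restrict unitSq)
  growth : ∀ᵐ p ∂volume.restrict unitSq, ∀ z, ‖g p z‖ ≤ B * ‖z‖ + ‖b p‖

namespace Caratheodory

variable {n : ℕ} {g : ℝ × ℝ → Vec n → Vec n} {B : ℝ≥0} {b : ℝ × ℝ → ℝ}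

theorem memLp_superposition (hg : Caratheodory g B b) (l : L2Sq n) :
    MemLp (fun p => g p (prim l p)) 2 (volume.restrict unitSq) := by
  have h0 : MemLp (fun _ : ℝ × ℝ => B * ‖l‖) 2 (volume.restrict unitSq) := memLp_const _
  refine (h0.add hg.memLp.norm).mono' (aestronglyMeasurable_superposition hg.meas hg.cont
    (aestronglyMeasurable_prim l)) ?_
  filter_upwards [hg.growth, ae_restrict_mem measurableSet_unitSq] with p h1 hp
  refine (h1 _).trans ?_
  rw [Pi.add_apply]
  gcongr
  exact norm_prim_le_norm l hp

/-- The operator `l ↦ g(·, ∫₀ˣ∫₀ʸ l)` of `L²(Q, ℝⁿ)`. -/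
noncomputable def op (hg : Caratheodory g B b) (l : L2Sq n) : L2Sq n :=
  (hg.memLp_superposition l).toLp _

theorem op_ae_eq (hg : Caratheodory g B b) (l : L2Sq n) :
    hg.op l =ᵐ[volume.restrict unitSq] fun p => g p (prim l p) :=
  (hg.memLp_superposition l).coeFn_toLp

theorem enorm_op_le (hg : Caratheodory g B b) (l : L2Sq n) :
    ∀ᵐ p ∂volume.restrict unitSq,
      ‖hg.op l p‖ₑ ≤ B * (∫⁻ q in rect p, ‖l q‖ₑ) + ‖b p‖ₑ := by
  filter_upwards [hg.op_ae_eq l, hg.growth] with p h1 h2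
  rw [h1]
  have h3 : ‖g p (prim l p)‖ₑ ≤ B * ‖prim l p‖ₑ + ‖b p‖ₑ := by
    have := ENNReal.ofReal_le_ofReal (h2 (prim l p))
    rwa [ENNReal.ofReal_add (by positivity) (norm_nonneg _), ENNReal.ofReal_mul B.coe_nonneg,
      ofReal_norm, ofReal_norm, ofReal_norm, ENNReal.ofReal_coe_nnreal] at this
  refine h3.trans ?_
  gcongr
  exact enorm_prim_le _ _

theorem volterraLipschitz_op (hg : Caratheodory g B b) {C : ℝ≥0}
    (hC : ∀ᵐ p ∂volume.restrict unitSq, LipschitzWith C (g p)) :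
    VolterraLipschitz C hg.op := by
  intro l m
  filter_upwards [hg.op_ae_eq l, hg.op_ae_eq m, hC, ae_restrict_mem measurableSet_unitSq]
    with p h1 h2 h3 hp
  rw [h1, h2, ← edist_eq_enorm_sub]
  refine (h3 _ _).trans ?_
  gcongr
  rw [edist_eq_enorm_sub, ← prim_sub l m hp, ← lintegral_rect_sub l m hp]
  exact enorm_prim_le _ _

end Caratheodory

/-! ### Differentiability of superposition operators -/

/-- Dominated convergence in `L²` of the square, with a constant bound. -/
theorem tendsto_eLpNorm_zero_of_bounded {n : ℕ} {ι : Type*} {L : Filter ι}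
    [L.IsCountablyGenerated] {F : ι → ℝ × ℝ → Vec n} {K : ℝ≥0}
    (hm : ∀ i, AEStronglyMeasurable (F i) (volume.restrict unitSq))
    (hb : ∀ᶠ i in L, ∀ᵐ p ∂volume.restrict unitSq, ‖F i p‖ₑ ≤ K)
    (hl : ∀ᵐ p ∂volume.restrict unitSq, Tendsto (fun i => F i p) L (𝓝 0)) :
    Tendsto (fun i => eLpNorm (F i) 2 (volume.restrict unitSq)) L (𝓝 0) := by
  have e (f : ℝ × ℝ → Vec n) :
      eLpNorm f 2 (volume.restrict unitSq) ^ ((2 : ℝ≥0) : ℝ) =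
        ∫⁻ p in unitSq, ‖f p‖ₑ ^ ((2 : ℝ≥0) : ℝ) :=
    eLpNorm_nnreal_pow_eq_lintegral two_ne_zero
  have h1 : Tendsto (fun i => ∫⁻ p in unitSq, ‖F i p‖ₑ ^ ((2 : ℝ≥0) : ℝ)) L
      (𝓝 (∫⁻ _ in unitSq, (0 : ℝ≥0∞))) := by
    refine tendsto_lintegral_filter_of_dominated_convergence'
      (fun _ => (K : ℝ≥0∞) ^ ((2 : ℝ≥0) : ℝ)) (Eventually.of_forall fun i =>
        (hm i).enorm.pow_const _) ?_ ?_ ?_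
    · filter_upwards [hb] with i hi
      filter_upwards [hi] with p hp
      gcongr
    · rw [lintegral_const, measure_univ, mul_one]
      exact ENNReal.rpow_ne_top_of_nonneg (NNReal.coe_nonneg 2) ENNReal.coe_ne_top
    · filter_upwards [hl] with p hp
      have h2 := ((ENNReal.continuous_rpow_const (y := ((2 : ℝ≥0) : ℝ))).tendsto 0).comp
        (tendsto_zero_iff_enorm_tendsto_zero.1 hp)
      rw [ENNReal.zero_rpow_of_pos (by norm_num)] at h2
      exact h2
  rw [lintegral_zero] at h1
  have h2 := ((ENNReal.continuous_rpow_const (y := ((2 : ℝ≥0) : ℝ)⁻¹)).tendsto 0).comp h1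
  rw [ENNReal.zero_rpow_of_pos (by norm_num)] at h2
  refine h2.congr fun i => ?_
  rw [Function.comp_apply, ← e, ENNReal.rpow_rpow_inv (by norm_num)]

/-- A function with values in the linear maps of `ℝⁿ` is measurable if its values at all vectors
are. -/
theorem aestronglyMeasurable_clm_of_apply {n : ℕ} {α : Type*} [MeasurableSpace α] {μ : Measure α}
    {D : α → Vec n →L[ℝ] Vec n} (h : ∀ z, AEStronglyMeasurable (fun p => D p z) μ) :
    AEStronglyMeasurable D μ := by
  have e : D = fun p => ∑ i : Fin n, ContinuousLinearMap.smulRightL ℝ (Vec n) (Vec n)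
      (EuclideanSpace.proj i) (D p (EuclideanSpace.single i 1)) := by
    funext p
    ext1 z
    rw [sum_apply]
    conv_lhs => rw [← (EuclideanSpace.basisFun (Fin n) ℝ).sum_repr z, map_sum]
    simp
  rw [e]
  exact Finset.aestronglyMeasurable_fun_sum _ fun i _ =>
    (ContinuousLinearMap.continuous _).comp_aestronglyMeasurable (h _)

/-- The derivative along a measurable function is a pointwise limit of difference quotients. -/
theorem aestronglyMeasurable_fderiv_superposition {n : ℕ} {g : ℝ × ℝ → Vec n → Vec n}
    {μ : Measure (ℝ × ℝ)} (hm : ∀ z, AEStronglyMeasurable (fun p => g p z) μ)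
    (hd : ∀ᵐ p ∂μ, Differentiable ℝ (g p)) {w : ℝ × ℝ → Vec n} (hw : AEStronglyMeasurable w μ) :
    AEStronglyMeasurable (fun p => fderiv ℝ (g p) (w p)) μ := by
  refine aestronglyMeasurable_clm_of_apply fun z => ?_
  have hc : ∀ᵐ p ∂μ, Continuous (g p) := hd.mono fun p hp => hp.continuous
  refine aestronglyMeasurable_of_tendsto_ae atTop (f := fun (k : ℕ) p =>
    ((k : ℝ) • (g p (w p + (k : ℝ)⁻¹ • z) - g p (w p)))) (fun k => ?_) ?_
  · have h1 := aestronglyMeasurable_superposition hm hc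
      (hw.add (aestronglyMeasurable_const (b := (k : ℝ)⁻¹ • z)))
    exact (h1.sub (aestronglyMeasurable_superposition hm hc hw)).const_smul (k : ℝ)
  · filter_upwards [hd] with p hp
    refine (hp (w p)).hasFDerivAt.lim z (c := fun k : ℕ => (k : ℝ)) ?_
    simpa using tendsto_natCast_atTop_atTop

/-- The derivatives of `g(p, ·)` are bounded on bounded sets, uniformly in `p`. -/
def DerivBounded {n : ℕ} (g : ℝ × ℝ → Vec n → Vec n) : Prop :=
  ∀ ρ : ℝ, ∃ M : ℝ≥0, ∀ᵐ p ∂volume.restrict unitSq, ∀ z, ‖z‖ ≤ ρ → ‖fderiv ℝ (g p) z‖ ≤ M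

namespace Caratheodory

variable {n : ℕ} {g : ℝ × ℝ → Vec n → Vec n} {B : ℝ≥0} {b : ℝ × ℝ → ℝ}

/-- The superposition operator is differentiable, although it acts in `L²`: its argument enters
through `∫₀ˣ∫₀ʸ l`, which is bounded. The derivative is multiplication by
`g_z(·, ∫₀ˣ∫₀ʸ l)` after the double integral. -/
theorem exists_hasFDerivAt_op (hg : Caratheodory g B b)
    (hd : ∀ᵐ p ∂volume.restrict unitSq, Differentiable ℝ (g p)) (hM : DerivBounded g)
    (l : L2Sq n) :
    ∃ (K : L2Sq n →L[ℝ] L2Sq n) (M : ℝ≥0), HasFDerivAt hg.op K l ∧ VolterraLipschitz M K := by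
  obtain ⟨M, hM⟩ := hM (‖l‖ + 1)
  set D : ℝ × ℝ → Vec n →L[ℝ] Vec n := fun p => fderiv ℝ (g p) (prim l p) with hDdef
  have hD : AEStronglyMeasurable D (volume.restrict unitSq) :=
    aestronglyMeasurable_fderiv_superposition hg.meas hd (aestronglyMeasurable_prim l)
  have hDM : ∀ᵐ p ∂volume.restrict unitSq, ‖D p‖ₑ ≤ M := by
    filter_upwards [hM, ae_restrict_mem measurableSet_unitSq] with p h1 hp
    have h2 := h1 (prim l p) ((norm_prim_le_norm l hp).trans (by linarith))
    exact enorm_le_coe.2 h2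
  have hK : ∀ m : L2Sq n, multOp D M hD hDM (primL n m) =ᵐ[volume.restrict unitSq]
      fun p => D p (prim m p) := by
    intro m
    filter_upwards [multOp_ae_eq hD hDM (primL n m), primL_ae_eq m] with p h1 h2
    rw [h1, h2]
  refine ⟨multOp D M hD hDM ∘L primL n, M, ?_, ?_⟩
  · -- The difference quotients are bounded by the mean value inequality on the ball of radius
    -- `‖l‖ + 1`, which contains the values of `∫₀ˣ∫₀ʸ x` for `x` near `l`.
    set F : L2Sq n → ℝ × ℝ → Vec n := fun x p =>
      ‖x - l‖⁻¹ • (g p (prim x p) - g p (prim l p) - D p (prim (x - l : L2Sq n) p)) with hF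
    have hFm : ∀ x, AEStronglyMeasurable (F x) (volume.restrict unitSq) := fun x =>
      (((aestronglyMeasurable_superposition hg.meas hg.cont (aestronglyMeasurable_prim x)).sub
        (aestronglyMeasurable_superposition hg.meas hg.cont (aestronglyMeasurable_prim l))).sub
        ((Lp.aestronglyMeasurable _).congr (hK (x - l)))).const_smul (‖x - l‖⁻¹)
    have hFb : ∀ᶠ x in 𝓝 l, ∀ᵐ p ∂volume.restrict unitSq, ‖F x p‖ₑ ≤ (2 * M : ℝ≥0) := by
      filter_upwards [Metric.ball_mem_nhds l one_pos] with x hx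
      have hx' : ‖x‖ ≤ ‖l‖ + 1 := by
        rw [mem_ball_iff_norm] at hx
        have := norm_le_norm_add_norm_sub' x l
        linarith
      filter_upwards [hd, hM, ae_restrict_mem measurableSet_unitSq] with p h1 h2 hp
      have hpx : ‖prim (x - l : L2Sq n) p‖ ≤ ‖x - l‖ := norm_prim_le_norm _ hp
      have e1 : ‖g p (prim x p) - g p (prim l p)‖ ≤ M * ‖prim x p - prim l p‖ := by
        refine (convex_closedBall (0 : Vec n) (‖l‖ + 1)).norm_image_sub_le_of_norm_fderiv_le
          (fun z _ => h1 z) (fun z hz => h2 z (mem_closedBall_zero_iff.1 hz)) ?_ ?_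
        · exact mem_closedBall_zero_iff.2 ((norm_prim_le_norm l hp).trans (by linarith))
        · exact mem_closedBall_zero_iff.2 ((norm_prim_le_norm x hp).trans hx')
      have e2 : ‖D p (prim (x - l : L2Sq n) p)‖ ≤ M * ‖prim (x - l : L2Sq n) p‖ :=
        (D p).le_of_opNorm_le (h2 _ ((norm_prim_le_norm l hp).trans (by linarith))) _
      rw [← prim_sub x l hp] at e1
      refine enorm_le_coe.2 ?_
      change ‖F x p‖ ≤ ((2 * M : ℝ≥0) : ℝ)
      rw [hF, norm_smul, norm_inv, norm_norm]
      rcases eq_or_ne x l with rfl | hxl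
      · simp
      rw [inv_mul_le_iff₀ (norm_pos_iff.2 (sub_ne_zero.2 hxl))]
      calc _ ≤ M * ‖prim (x - l : L2Sq n) p‖ + M * ‖prim (x - l : L2Sq n) p‖ :=
            (norm_sub_le _ _).trans (add_le_add e1 e2)
        _ ≤ M * ‖x - l‖ + M * ‖x - l‖ := by gcongr
        _ = _ := by push_cast; ring
    have hFl : ∀ᵐ p ∂volume.restrict unitSq, Tendsto (fun x => F x p) (𝓝 l) (𝓝 0) := by
      filter_upwards [hd, ae_restrict_mem measurableSet_unitSq] with p h1 hp
      have hn : Tendsto (fun x : L2Sq n => ‖x - l‖) (𝓝 l) (𝓝 0) := by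
        simpa using (tendsto_id (x := 𝓝 l)).sub_const l |>.norm
      have hη : Tendsto (fun x : L2Sq n => prim (x - l : L2Sq n) p) (𝓝 l) (𝓝 0) :=
        squeeze_zero_norm (fun x => norm_prim_le_norm _ hp) hn
      have ho := (hasFDerivAt_iff_isLittleO_nhds_zero.1
        (h1 (prim l p)).hasFDerivAt).comp_tendsto hη
      have hO : (fun x : L2Sq n => prim (x - l : L2Sq n) p) =O[𝓝 l] fun x => ‖x - l‖ := by
        refine Asymptotics.IsBigO.of_bound 1 (Eventually.of_forall fun x => ?_)
        rw [norm_norm, one_mul]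
        exact norm_prim_le_norm _ hp
      refine (ho.trans_isBigO hO).tendsto_inv_smul_nhds_zero.congr fun x => ?_
      simp only [hF, Function.comp_apply, prim_sub x l hp, add_sub_cancel, hDdef]
    have hlim := tendsto_eLpNorm_zero_of_bounded hFm hFb hFl
    rw [hasFDerivAt_iff_tendsto]
    have e : ∀ x, eLpNorm (F x) 2 (volume.restrict unitSq) =
        ‖‖x - l‖⁻¹ • (hg.op x - hg.op l - (multOp D M hD hDM ∘L primL n) (x - l))‖ₑ := by
      intro x
      rw [Lp.enorm_def]
      refine eLpNorm_congr_ae ?_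
      filter_upwards [Lp.coeFn_smul ‖x - l‖⁻¹
          (hg.op x - hg.op l - (multOp D M hD hDM ∘L primL n) (x - l)),
        Lp.coeFn_sub (hg.op x - hg.op l) ((multOp D M hD hDM ∘L primL n) (x - l)),
        Lp.coeFn_sub (hg.op x) (hg.op l), hg.op_ae_eq x, hg.op_ae_eq l, hK (x - l)]
        with p h1 h2 h3 h4 h5 h6
      rw [h1, Pi.smul_apply, h2, Pi.sub_apply, h3, Pi.sub_apply, h4, h5,
        ContinuousLinearMap.comp_apply, h6]
    simp only [e] at hlim
    refine (tendsto_zero_iff_norm_tendsto_zero.1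
      (tendsto_zero_iff_enorm_tendsto_zero.2 hlim)).congr fun x => ?_
    rw [norm_smul, norm_inv, norm_norm]
  · intro m m'
    filter_upwards [hK m, hK m', hDM, ae_restrict_mem measurableSet_unitSq] with p h1 h2 h3 hp
    rw [ContinuousLinearMap.comp_apply, ContinuousLinearMap.comp_apply, h1, h2, ← map_sub,
      ← prim_sub m m' hp, ← lintegral_rect_sub m m' hp]
    refine ((D p).le_opENorm _).trans ?_
    gcongr
    exact enorm_prim_le _ _

end Caratheodory

/-! ### Radial truncation -/

/-- The radial retraction of `ℝⁿ` onto the ball of radius `ρ`. -/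
noncomputable def radialTrunc {n : ℕ} (ρ : ℝ) (z : Vec n) : Vec n := (ρ / max ρ ‖z‖) • z

theorem radialTrunc_of_norm_le {n : ℕ} {ρ : ℝ} (hρ : 0 < ρ) {z : Vec n} (hz : ‖z‖ ≤ ρ) :
    radialTrunc ρ z = z := by
  rw [radialTrunc, max_eq_left hz, div_self hρ.ne', one_smul]

theorem norm_radialTrunc {n : ℕ} {ρ : ℝ} (hρ : 0 < ρ) (z : Vec n) :
    ‖radialTrunc ρ z‖ = ρ * ‖z‖ / max ρ ‖z‖ := by
  have h : 0 < max ρ ‖z‖ := lt_max_of_lt_left hρ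
  rw [radialTrunc, norm_smul, Real.norm_of_nonneg (by positivity)]
  ring

theorem norm_radialTrunc_le {n : ℕ} {ρ : ℝ} (hρ : 0 < ρ) (z : Vec n) :
    ‖radialTrunc ρ z‖ ≤ ρ := by
  rw [norm_radialTrunc hρ, div_le_iff₀ (lt_max_of_lt_left hρ)]
  gcongr
  exact le_max_right _ _

theorem norm_radialTrunc_le_norm {n : ℕ} {ρ : ℝ} (hρ : 0 < ρ) (z : Vec n) :
    ‖radialTrunc ρ z‖ ≤ ‖z‖ := by
  rw [norm_radialTrunc hρ, div_le_iff₀ (lt_max_of_lt_left hρ), mul_comm]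
  gcongr
  exact le_max_left _ _

theorem lipschitzWith_radialTrunc {n : ℕ} {ρ : ℝ} (hρ : 0 < ρ) :
    LipschitzWith 2 (radialTrunc ρ : Vec n → Vec n) := by
  refine LipschitzWith.of_dist_le_mul fun z w => ?_
  rw [dist_eq_norm, dist_eq_norm]
  set a := max ρ ‖z‖ with ha
  set c := max ρ ‖w‖ with hc
  have ha0 : 0 < a := lt_max_of_lt_left hρ
  have hc0 : 0 < c := lt_max_of_lt_left hρ
  have hac : |c - a| ≤ ‖z - w‖ := by
    have h := abs_max_sub_max_le_abs ‖w‖ ‖z‖ ρ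
    rw [max_comm ‖w‖, max_comm ‖z‖] at h
    refine h.trans ?_
    rw [norm_sub_rev]
    exact abs_norm_sub_norm_le w z
  have e : radialTrunc ρ z - radialTrunc ρ w =
      (ρ / a) • (z - w) + (ρ / a * ((c - a) / c)) • w := by
    rw [radialTrunc, radialTrunc, ← ha, ← hc, smul_sub, sub_add, ← sub_smul]
    congr 2
    field_simp
    ring
  have h1 : ρ / a ≤ 1 := (div_le_one ha0).2 (le_max_left _ _)
  have h2 : ‖w‖ / c ≤ 1 := (div_le_one hc0).2 (le_max_right _ _)
  rw [e]
  calc _ ≤ ρ / a * ‖z - w‖ + ρ / a * (|c - a| / c) * ‖w‖ := by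
        refine (norm_add_le _ _).trans (le_of_eq ?_)
        rw [norm_smul, norm_smul, norm_mul, Real.norm_of_nonneg (by positivity :
          0 ≤ ρ / a), norm_div, Real.norm_of_nonneg hc0.le, Real.norm_eq_abs]
    _ = ρ / a * (‖z - w‖ + |c - a| * (‖w‖ / c)) := by ring
    _ ≤ 1 * (‖z - w‖ + ‖z - w‖ * 1) := by gcongr
    _ = _ := by push_cast; ring

namespace Caratheodory

variable {n : ℕ} {g : ℝ × ℝ → Vec n → Vec n} {B : ℝ≥0} {b : ℝ × ℝ → ℝ}

theorem radialTrunc (hg : Caratheodory g B b) {ρ : ℝ} (hρ : 0 < ρ) :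
    Caratheodory (fun p z => g p (radialTrunc ρ z)) B b where
  meas z := hg.meas _
  cont := hg.cont.mono fun _ h => h.comp (lipschitzWith_radialTrunc hρ).continuous
  memLp := hg.memLp
  growth := by
    filter_upwards [hg.growth] with p h z
    refine (h _).trans ?_
    gcongr
    exact norm_radialTrunc_le_norm hρ z

theorem exists_volterraLipschitz_op_radialTrunc (hg : Caratheodory g B b)
    (hd : ∀ᵐ p ∂volume.restrict unitSq, Differentiable ℝ (g p)) (hM : DerivBounded g)
    {ρ : ℝ} (hρ : 0 < ρ) : ∃ C : ℝ≥0, VolterraLipschitz C (hg.radialTrunc hρ).op := by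
  obtain ⟨M, hM⟩ := hM ρ
  refine ⟨M * 2, volterraLipschitz_op _ ?_⟩
  filter_upwards [hd, hM] with p h1 h2
  have h3 : LipschitzOnWith M (g p) (Metric.closedBall 0 ρ) :=
    (convex_closedBall (0 : Vec n) ρ).lipschitzOnWith_of_nnnorm_fderiv_le (fun z _ => h1 z)
      fun z hz => h2 z (mem_closedBall_zero_iff.1 hz)
  rw [← lipschitzOnWith_univ]
  exact h3.comp ((lipschitzWith_radialTrunc hρ).lipschitzOnWith (s := univ))
    fun z _ => mem_closedBall_zero_iff.2 (norm_radialTrunc_le hρ z)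

/-- The truncation is invisible to functions with `|∫₀ˣ∫₀ʸ l| ≤ ρ`. -/
theorem op_radialTrunc_eq (hg : Caratheodory g B b) {ρ : ℝ} (hρ : 0 < ρ) {l : L2Sq n}
    (hl : ∀ p ∈ unitSq, ‖prim l p‖ ≤ ρ) : (hg.radialTrunc hρ).op l = hg.op l := by
  refine MemLp.toLp_congr _ _ ?_
  filter_upwards [ae_restrict_mem measurableSet_unitSq] with p hp
  rw [radialTrunc_of_norm_le hρ (hl p hp)]

end Caratheodory

/-! ### Partial derivatives of double integrals -/

theorem pdx_ae_eq_sliceInt {n : ℕ} {l z : ℝ × ℝ → Vec n} (hl : IntegrableOn l unitSq)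
    (hz : ∀ p ∈ unitSq, z p = prim l p) :
    pdx z =ᵐ[volume.restrict unitSq] sliceInt l := by
  set k := unitSq.indicator l with hk
  have hki : Integrable k := (integrable_indicator_iff measurableSet_unitSq).2 hl
  have hlk : l =ᵐ[volume.restrict unitSq] k :=
    (indicator_ae_eq_restrict measurableSet_unitSq).symm
  have hz' : ∀ x ∈ Icc (0 : ℝ) 1, ∀ y ∈ Icc (0 : ℝ) 1,
      z (x, y) = (∫ u in (0 : ℝ)..x, ∫ t in Iic y, k (u, t)) -
        ∫ u in (0 : ℝ)..x, ∫ t in Iic 0, k (u, t) := by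
    intro x hx y hy
    rw [hz (x, y) ⟨hx, hy⟩, ← setIntegral_rect hki hx.1 hy.1]
    exact prim_congr_ae hlk ⟨hx, hy⟩
  have hx : ∀ᵐ x, x ∈ Icc (0 : ℝ) 1 → ∀ y ∈ Icc (0 : ℝ) 1,
      pdx z (x, y) = sliceInt k (x, y) := by
    have H1 : ∀ᵐ x, Integrable (fun t => k (x, t)) := by
      rw [Measure.volume_eq_prod] at hki
      exact hki.prod_right_ae
    filter_upwards [ae_forall_hasDerivAt_integral_fst hki, H1] with x hx hkx hx1 y hy
    have := ((hx y).sub (hx 0)).hasDerivWithinAt (s := Icc (0 : ℝ) 1)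
    refine HasDerivWithinAt.derivWithin ?_ (uniqueDiffOn_Icc zero_lt_one x hx1)
    rw [intervalIntegral.integral_Iic_sub_Iic hkx.integrableOn hkx.integrableOn,
      intervalIntegral.integral_of_le hy.1, ← integral_Icc_eq_integral_Ioc] at this
    exact this.congr (fun s hs => hz' s hs y hy) (hz' x hx1 y hy)
  have hx' : ∀ᵐ p : ℝ × ℝ, p.1 ∈ Icc (0 : ℝ) 1 → ∀ y ∈ Icc (0 : ℝ) 1,
      pdx z (p.1, y) = sliceInt k (p.1, y) := by
    rw [Measure.volume_eq_prod]
    exact Measure.quasiMeasurePreserving_fst.ae hx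
  refine EventuallyEq.trans ?_ (sliceInt_congr_ae hlk).symm
  filter_upwards [ae_restrict_mem measurableSet_unitSq, ae_restrict_of_ae hx'] with p hp h1
  exact h1 hp.1 p.2 hp.2

theorem prim_swap {n : ℕ} (l : L2Sq n) {p : ℝ × ℝ} (hp : p ∈ unitSq) :
    prim l p.swap = prim (swapL n l) p := by
  rw [prim_congr_ae (swapL_ae_eq l) hp]
  exact ((measurePreserving_swap_rect p).integral_comp
    MeasurableEquiv.prodComm.measurableEmbedding l).symm

theorem pdx_ae_eq_sliceL {n : ℕ} {l : L2Sq n} {z : ℝ × ℝ → Vec n}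
    (hz : ∀ p ∈ unitSq, z p = prim l p) : pdx z =ᵐ[volume.restrict unitSq] sliceL n l :=
  (pdx_ae_eq_sliceInt (integrableOn_coe l) hz).trans (sliceL_ae_eq l).symm

theorem pdy_ae_eq_sliceL' {n : ℕ} {l : L2Sq n} {z : ℝ × ℝ → Vec n}
    (hz : ∀ p ∈ unitSq, z p = prim l p) : pdy z =ᵐ[volume.restrict unitSq] sliceL' n l := by
  have h := pdx_ae_eq_sliceL (l := swapL n l) (z := z ∘ Prod.swap) fun p hp => by
    rw [← prim_swap l hp]
    exact hz p.swap ⟨hp.2, hp.1⟩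
  have h2 := measurePreserving_swap_unitSq.quasiMeasurePreserving.ae_eq_comp h
  exact h2.trans (swapL_ae_eq (sliceL n (swapL n l))).symm

/-! ### Reduction of the system to an equation in `L²(Q, ℝⁿ)` -/

theorem AC02.eq_prim_mixed {n : ℕ} (z : AC02 n) {p : ℝ × ℝ} (hp : p ∈ unitSq) :
    z p = prim (AC02.mixed n z) p := by
  rw [z.mem.eq_integral p hp]
  exact prim_congr_ae z.mem.memLp.coeFn_toLp.symm hp

theorem AC02.mixed_surjective (n : ℕ) : Function.Surjective (AC02.mixed n) := by
  intro l
  have h := memAC02_of_integral (z := unitSq.indicator (prim l)) (Lp.memLp l)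
    (fun p hp => indicator_of_mem hp _) fun p hp => indicator_of_notMem hp _
  refine ⟨(⟨_, h.1⟩ : AC02Submodule n), ?_⟩
  refine Lp.ext ?_
  exact h.1.memLp.coeFn_toLp.trans h.2

/-- The isometry `z ↦ z_{xy}` of `AC₀²(Q, ℝⁿ)` onto `L²(Q, ℝⁿ)`. -/
noncomputable def AC02.mixedEquiv (n : ℕ) : AC02 n ≃ₗᵢ[ℝ] L2Sq n :=
  LinearIsometryEquiv.ofSurjective ⟨AC02.mixed n, fun _ => rfl⟩ (AC02.mixed_surjective n)

theorem AC02.mixedEquiv_apply {n : ℕ} (z : AC02 n) : AC02.mixedEquiv n z = AC02.mixed n z := rfl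

theorem enorm_multOp_le {n : ℕ} {D : ℝ × ℝ → Vec n →L[ℝ] Vec n} {C : ℝ≥0}
    (hD : AEStronglyMeasurable D (volume.restrict unitSq))
    (hC : ∀ᵐ p ∂volume.restrict unitSq, ‖D p‖ₑ ≤ C) (m : L2Sq n) :
    ∀ᵐ p ∂volume.restrict unitSq, ‖multOp D C hD hC m p‖ₑ ≤ C * ‖m p‖ₑ := by
  filter_upwards [multOp_ae_eq hD hC m, hC] with p h1 h2
  rw [h1]
  exact ((D p).le_opENorm _).trans (by gcongr)

/-- In terms of `z_{xy}` the system is the equation `l + T l = v` in `L²(Q, ℝⁿ)`. -/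
theorem isSolution_iff {n : ℕ} {f₁ f₂ : ℝ × ℝ → Vec n → Vec n}
    {A₁ A₂ : ℝ × ℝ → Vec n →L[ℝ] Vec n} {B : ℝ≥0} {b : ℝ × ℝ → ℝ}
    (hf₁ : Caratheodory f₁ B b) (hf₂ : Caratheodory f₂ B b)
    (hA₁ : AEStronglyMeasurable A₁ (volume.restrict unitSq))
    (hA₂ : AEStronglyMeasurable A₂ (volume.restrict unitSq))
    (hB₁ : ∀ᵐ p ∂volume.restrict unitSq, ‖A₁ p‖ₑ ≤ B)
    (hB₂ : ∀ᵐ p ∂volume.restrict unitSq, ‖A₂ p‖ₑ ≤ B) {v : L2Sq n} {z : AC02 n} :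
    IsSolution f₁ f₂ A₁ A₂ v z ↔
      AC02.mixed n z + systemOp hf₁.op hf₂.op (multOp A₁ B hA₁ hB₁) (multOp A₂ B hA₂ hB₂)
        (AC02.mixed n z) = v := by
  set l := AC02.mixed n z with hl
  have hz : ∀ p ∈ unitSq, z p = prim l p := fun p hp => z.eq_prim_mixed hp
  set L₁ := multOp A₁ B hA₁ hB₁ with hL₁
  set L₂ := multOp A₂ B hA₂ hB₂ with hL₂
  set e := hf₂.op l + (L₁ (sliceL n l) + L₂ (sliceL' n l)) with he
  have hint : (fun q => f₂ q (z q) + A₁ q (pdx z q) + A₂ q (pdy z q))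
      =ᵐ[volume.restrict unitSq] e := by
    filter_upwards [hf₂.op_ae_eq l, multOp_ae_eq hA₁ hB₁ (sliceL n l),
      multOp_ae_eq hA₂ hB₂ (sliceL' n l), pdx_ae_eq_sliceL hz, pdy_ae_eq_sliceL' hz,
      Lp.coeFn_add (hf₂.op l) (L₁ (sliceL n l) + L₂ (sliceL' n l)),
      Lp.coeFn_add (L₁ (sliceL n l)) (L₂ (sliceL' n l)), ae_restrict_mem measurableSet_unitSq]
      with q h1 h2 h3 h4 h5 h6 h7 hq
    rw [he, h6, Pi.add_apply, h7, Pi.add_apply, h1, h2, h3, h4, h5, hz q hq, add_assoc]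
  have heq : (fun p => pdy (pdx z) p + f₁ p (z p) +
      ∫ q in rect p, (f₂ q (z q) + A₁ q (pdx z q) + A₂ q (pdy z q)))
      =ᵐ[volume.restrict unitSq] (l + systemOp hf₁.op hf₂.op L₁ L₂ l : L2Sq n) := by
    have h0 : l =ᵐ[volume.restrict unitSq] pdy (pdx z) := z.mem.memLp.coeFn_toLp
    filter_upwards [h0, hf₁.op_ae_eq l, primL_ae_eq e, Lp.coeFn_add l
      (systemOp hf₁.op hf₂.op L₁ L₂ l), Lp.coeFn_add (hf₁.op l) (primL n e),
      ae_restrict_mem measurableSet_unitSq] with p h1 h2 h3 h4 h5 hp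
    have h6 : ∫ q in rect p, (f₂ q (z q) + A₁ q (pdx z q) + A₂ q (pdy z q)) = prim e p :=
      prim_congr_ae hint hp
    rw [h4, Pi.add_apply, systemOp, ← he, h5, Pi.add_apply, h1, h2, h3, h6, hz p hp, add_assoc]
  constructor
  · intro h
    exact Lp.ext (heq.symm.trans h.equation)
  · intro h
    refine ⟨(integrableOn_coe e).congr hint.symm, ?_⟩
    rw [h] at heq
    exact heq

/-! ### Unique solvability and differentiable dependence in `L²(Q, ℝⁿ)` -/

theorem VolterraLipschitz.mono {n : ℕ} {C C' : ℝ≥0} (h : C ≤ C') {T : L2Sq n → L2Sq n}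
    (hT : VolterraLipschitz C T) : VolterraLipschitz C' T := fun l m => by
  filter_upwards [hT l m] with p hp
  refine hp.trans ?_
  gcongr

section Solvability

variable {n : ℕ} {f₁ f₂ : ℝ × ℝ → Vec n → Vec n} {L₁ L₂ : L2Sq n →L[ℝ] L2Sq n} {B : ℝ≥0}
  {b : ℝ × ℝ → ℝ}

/-- The a priori bound depends on the growth constants only, so that it holds for all truncations
of the nonlinear terms at once. -/
theorem exists_prim_bound (hb : MemLp b 2 (volume.restrict unitSq))
    (h₁ : ∀ m : L2Sq n, ∀ᵐ p ∂volume.restrict unitSq, ‖L₁ m p‖ₑ ≤ B * ‖m p‖ₑ)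
    (h₂ : ∀ m : L2Sq n, ∀ᵐ p ∂volume.restrict unitSq, ‖L₂ m p‖ₑ ≤ B * ‖m p‖ₑ) (r : ℝ) :
    ∃ ρ > (0 : ℝ), ∀ (g₁ g₂ : ℝ × ℝ → Vec n → Vec n) (hg₁ : Caratheodory g₁ B b)
      (hg₂ : Caratheodory g₂ B b) (l : L2Sq n),
      ‖l + systemOp hg₁.op hg₂.op L₁ L₂ l‖ ≤ r → ∀ p ∈ unitSq, ‖prim l p‖ ≤ ρ := by
  set β := ∫⁻ q in unitSq, ‖b q‖ₑ with hβ
  have hβt : β ≠ ∞ := ((hb.integrable one_le_two).2).ne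
  set R : ℝ≥0∞ := gronwallConst (2 * B + 2 * B) * (ENNReal.ofReal r + 2 * β) with hR
  have hRt : R ≠ ∞ := ENNReal.mul_ne_top ENNReal.coe_ne_top
    (ENNReal.add_ne_top.2 ⟨ENNReal.ofReal_ne_top, ENNReal.mul_ne_top (by simp) hβt⟩)
  refine ⟨R.toReal + 1, by positivity, fun g₁ g₂ hg₁ hg₂ l hl p hp => ?_⟩
  have h := enorm_prim_le_of_add_systemOp_eq hb.1.enorm (hg₁.enorm_op_le l) (hg₂.enorm_op_le l)
    h₁ h₂ rfl hp
  have h' : ‖prim l p‖ₑ ≤ R := by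
    refine h.trans ?_
    rw [hR]
    gcongr
    rw [← ofReal_norm]
    exact ENNReal.ofReal_le_ofReal hl
  have h3 := (ENNReal.toReal_le_toReal enorm_ne_top hRt).2 h'
  rw [toReal_enorm] at h3
  linarith

theorem exists_volterraLipschitz_systemOp_radialTrunc
    (hf₁ : Caratheodory f₁ B b) (hf₂ : Caratheodory f₂ B b)
    (hd₁ : ∀ᵐ p ∂volume.restrict unitSq, Differentiable ℝ (f₁ p))
    (hd₂ : ∀ᵐ p ∂volume.restrict unitSq, Differentiable ℝ (f₂ p))
    (hM₁ : DerivBounded f₁) (hM₂ : DerivBounded f₂)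
    (h₁ : ∀ m : L2Sq n, ∀ᵐ p ∂volume.restrict unitSq, ‖L₁ m p‖ₑ ≤ B * ‖m p‖ₑ)
    (h₂ : ∀ m : L2Sq n, ∀ᵐ p ∂volume.restrict unitSq, ‖L₂ m p‖ₑ ≤ B * ‖m p‖ₑ)
    {ρ : ℝ} (hρ : 0 < ρ) : ∃ C : ℝ≥0, VolterraLipschitz C
      (systemOp (hf₁.radialTrunc hρ).op (hf₂.radialTrunc hρ).op L₁ L₂) := by
  obtain ⟨C₁, hC₁⟩ := hf₁.exists_volterraLipschitz_op_radialTrunc hd₁ hM₁ hρ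
  obtain ⟨C₂, hC₂⟩ := hf₂.exists_volterraLipschitz_op_radialTrunc hd₂ hM₂ hρ
  exact ⟨_, (hC₁.mono (le_max_left C₁ C₂)).systemOp (hC₂.mono (le_max_right C₁ C₂)) h₁ h₂⟩

/-- Existence: a solution of the system truncated beyond the a priori bound solves the system. -/
theorem exists_add_systemOp_eq
    (hf₁ : Caratheodory f₁ B b) (hf₂ : Caratheodory f₂ B b)
    (hd₁ : ∀ᵐ p ∂volume.restrict unitSq, Differentiable ℝ (f₁ p))
    (hd₂ : ∀ᵐ p ∂volume.restrict unitSq, Differentiable ℝ (f₂ p))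
    (hM₁ : DerivBounded f₁) (hM₂ : DerivBounded f₂)
    (h₁ : ∀ m : L2Sq n, ∀ᵐ p ∂volume.restrict unitSq, ‖L₁ m p‖ₑ ≤ B * ‖m p‖ₑ)
    (h₂ : ∀ m : L2Sq n, ∀ᵐ p ∂volume.restrict unitSq, ‖L₂ m p‖ₑ ≤ B * ‖m p‖ₑ)
    (v : L2Sq n) : ∃ l, l + systemOp hf₁.op hf₂.op L₁ L₂ l = v := by
  obtain ⟨ρ, hρ, hbound⟩ := exists_prim_bound hf₁.memLp h₁ h₂ ‖v‖
  obtain ⟨C, hC⟩ := exists_volterraLipschitz_systemOp_radialTrunc hf₁ hf₂ hd₁ hd₂ hM₁ hM₂ h₁ h₂ hρ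
  obtain ⟨l, hl⟩ := hC.exists_add_eq v
  have hlρ := hbound _ _ (hf₁.radialTrunc hρ) (hf₂.radialTrunc hρ) l (by rw [hl])
  refine ⟨l, ?_⟩
  rw [systemOp, ← hf₁.op_radialTrunc_eq hρ hlρ, ← hf₂.op_radialTrunc_eq hρ hlρ]
  exact hl

/-- Solutions depend Lipschitz continuously on right-hand sides in a bounded set; in particular
they are unique. -/
theorem exists_enorm_sub_le
    (hf₁ : Caratheodory f₁ B b) (hf₂ : Caratheodory f₂ B b)
    (hd₁ : ∀ᵐ p ∂volume.restrict unitSq, Differentiable ℝ (f₁ p))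
    (hd₂ : ∀ᵐ p ∂volume.restrict unitSq, Differentiable ℝ (f₂ p))
    (hM₁ : DerivBounded f₁) (hM₂ : DerivBounded f₂)
    (h₁ : ∀ m : L2Sq n, ∀ᵐ p ∂volume.restrict unitSq, ‖L₁ m p‖ₑ ≤ B * ‖m p‖ₑ)
    (h₂ : ∀ m : L2Sq n, ∀ᵐ p ∂volume.restrict unitSq, ‖L₂ m p‖ₑ ≤ B * ‖m p‖ₑ)
    (r : ℝ) : ∃ K : ℝ≥0, ∀ l m v w : L2Sq n, l + systemOp hf₁.op hf₂.op L₁ L₂ l = v →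
      m + systemOp hf₁.op hf₂.op L₁ L₂ m = w → ‖v‖ ≤ r → ‖w‖ ≤ r → ‖l - m‖ₑ ≤ K * ‖v - w‖ₑ := by
  obtain ⟨ρ, hρ, hbound⟩ := exists_prim_bound hf₁.memLp h₁ h₂ r
  obtain ⟨C, hC⟩ := exists_volterraLipschitz_systemOp_radialTrunc hf₁ hf₂ hd₁ hd₂ hM₁ hM₂ h₁ h₂ hρ
  refine ⟨1 + C * gronwallConst C, fun l m v w hl hm hv hw => ?_⟩
  have hlρ := hbound _ _ hf₁ hf₂ l (hl ▸ hv)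
  have hmρ := hbound _ _ hf₁ hf₂ m (hm ▸ hw)
  refine enorm_sub_le_of_add_eq (hC l m) ?_ ?_
  · rw [systemOp, hf₁.op_radialTrunc_eq hρ hlρ, hf₂.op_radialTrunc_eq hρ hlρ]
    exact hl
  · rw [systemOp, hf₁.op_radialTrunc_eq hρ hmρ, hf₂.op_radialTrunc_eq hρ hmρ]
    exact hm

/-- The left-hand side of the system has an invertible Fréchet derivative everywhere: the
linearized system is of the same Volterra type. -/
theorem exists_hasFDerivAt_add_systemOp
    (hf₁ : Caratheodory f₁ B b) (hf₂ : Caratheodory f₂ B b)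
    (hd₁ : ∀ᵐ p ∂volume.restrict unitSq, Differentiable ℝ (f₁ p))
    (hd₂ : ∀ᵐ p ∂volume.restrict unitSq, Differentiable ℝ (f₂ p))
    (hM₁ : DerivBounded f₁) (hM₂ : DerivBounded f₂)
    (h₁ : ∀ m : L2Sq n, ∀ᵐ p ∂volume.restrict unitSq, ‖L₁ m p‖ₑ ≤ B * ‖m p‖ₑ)
    (h₂ : ∀ m : L2Sq n, ∀ᵐ p ∂volume.restrict unitSq, ‖L₂ m p‖ₑ ≤ B * ‖m p‖ₑ)
    (l : L2Sq n) : ∃ e : L2Sq n ≃L[ℝ] L2Sq n,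
      HasFDerivAt (fun l => l + systemOp hf₁.op hf₂.op L₁ L₂ l) (e : L2Sq n →L[ℝ] L2Sq n) l := by
  obtain ⟨K₁, C₁, hK₁, hC₁⟩ := hf₁.exists_hasFDerivAt_op hd₁ hM₁ l
  obtain ⟨K₂, C₂, hK₂, hC₂⟩ := hf₂.exists_hasFDerivAt_op hd₂ hM₂ l
  set K := K₁ + primL n ∘L (K₂ + (L₁ ∘L sliceL n + L₂ ∘L sliceL' n)) with hK
  have hKV : VolterraLipschitz (2 * max C₁ C₂ + 2 * B) K :=
    (hC₁.mono (le_max_left C₁ C₂)).systemOp (hC₂.mono (le_max_right C₁ C₂)) h₁ h₂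
  obtain ⟨e, he⟩ := hKV.exists_equiv_id_add
  refine ⟨e, ?_⟩
  rw [he]
  refine (hasFDerivAt_id l).add (hK₁.add ?_)
  exact (primL n).hasFDerivAt.comp l
    (hK₂.add (L₁ ∘L sliceL n + L₂ ∘L sliceL' n).hasFDerivAt)

/-- The solution operator is differentiable as a continuous inverse of a map with invertible
derivatives. -/
theorem exists_solutionOperator
    (hf₁ : Caratheodory f₁ B b) (hf₂ : Caratheodory f₂ B b)
    (hd₁ : ∀ᵐ p ∂volume.restrict unitSq, Differentiable ℝ (f₁ p))
    (hd₂ : ∀ᵐ p ∂volume.restrict unitSq, Differentiable ℝ (f₂ p))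
    (hM₁ : DerivBounded f₁) (hM₂ : DerivBounded f₂)
    (h₁ : ∀ m : L2Sq n, ∀ᵐ p ∂volume.restrict unitSq, ‖L₁ m p‖ₑ ≤ B * ‖m p‖ₑ)
    (h₂ : ∀ m : L2Sq n, ∀ᵐ p ∂volume.restrict unitSq, ‖L₂ m p‖ₑ ≤ B * ‖m p‖ₑ) :
    ∃ S : L2Sq n → L2Sq n, (∀ v l, l + systemOp hf₁.op hf₂.op L₁ L₂ l = v ↔ l = S v) ∧
      Differentiable ℝ S := by
  choose S hS using exists_add_systemOp_eq hf₁ hf₂ hd₁ hd₂ hM₁ hM₂ h₁ h₂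
  have hlip := exists_enorm_sub_le hf₁ hf₂ hd₁ hd₂ hM₁ hM₂ h₁ h₂
  refine ⟨S, fun v l => ⟨fun hl => ?_, fun hl => hl ▸ hS v⟩, fun v => ?_⟩
  · obtain ⟨K, hK⟩ := hlip ‖v‖
    have h := hK l (S v) v v hl (hS v) le_rfl le_rfl
    rw [sub_self, enorm_zero, mul_zero, nonpos_iff_eq_zero, enorm_eq_zero, sub_eq_zero] at h
    exact h
  · obtain ⟨K, hK⟩ := hlip (‖v‖ + 1)
    have hcont : ContinuousAt S v := by
      have hL : LipschitzOnWith K S (Metric.ball v 1) := by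
        have hb : ∀ x ∈ Metric.ball v 1, ‖x‖ ≤ ‖v‖ + 1 := fun x hx => by
          rw [mem_ball_iff_norm] at hx
          have := norm_le_norm_add_norm_sub' x v
          linarith
        intro x hx y hy
        rw [edist_eq_enorm_sub, edist_eq_enorm_sub]
        exact hK _ _ _ _ (hS x) (hS y) (hb x hx) (hb y hy)
      exact hL.continuousOn.continuousAt (Metric.ball_mem_nhds v one_pos)
    obtain ⟨e, he⟩ := exists_hasFDerivAt_add_systemOp hf₁ hf₂ hd₁ hd₂ hM₁ hM₂ h₁ h₂ (S v)
    exact (he.of_local_left_inverse hcont (Eventually.of_forall hS)).differentiableAt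

end Solvability

theorem DerivBoundedOnBounded.derivBounded {n : ℕ} {f₁ f₂ : ℝ × ℝ → Vec n → Vec n}
    (h : DerivBoundedOnBounded f₁ f₂) : DerivBounded f₁ ∧ DerivBounded f₂ := by
  refine ⟨fun ρ => ?_, fun ρ => ?_⟩ <;>
  · obtain ⟨M, hM⟩ := h (max ρ 1) (lt_max_of_lt_right one_pos)
    refine ⟨M.toNNReal, hM.mono fun p hp z hz => ?_⟩
    have h2 := hp z (hz.trans (le_max_left _ _))
    first
      | exact h2.1.trans (Real.le_coe_toNNReal M)
      | exact h2.2.trans (Real.le_coe_toNNReal M)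

end TwoDSystem

theorem theorem4p1 (n : ℕ) (f₁ f₂ : ℝ × ℝ → Vec n → Vec n)
    (A₁ A₂ : ℝ × ℝ → Vec n →L[ℝ] Vec n)
    (hreg : RegularData f₁ f₂ A₁ A₂) (hgrowth : LinearGrowth f₁ f₂ A₁ A₂)
    (hderiv : DerivBoundedOnBounded f₁ f₂) :
    (∀ v : L2Sq n, ∃! z : AC02 n, IsSolution f₁ f₂ A₁ A₂ v z) ∧
    ∃ S : L2Sq n → AC02 n, (∀ v, IsSolution f₁ f₂ A₁ A₂ v (S v)) ∧
      Continuous S ∧ Differentiable ℝ S := by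
  obtain ⟨B, hB, b, hb, hall⟩ := hgrowth
  lift B to NNReal using hB.le
  have hf₁ : Caratheodory f₁ B b := ⟨hreg.meas_f₁, hreg.contDiff_f₁.mono fun _ h => h.continuous,
    hb, hall.mono fun p h z => (h.2.1 z).1.trans (by gcongr; exact Real.le_norm_self _)⟩
  have hf₂ : Caratheodory f₂ B b := ⟨hreg.meas_f₂, hreg.contDiff_f₂.mono fun _ h => h.continuous,
    hb, hall.mono fun p h z => (h.2.1 z).2.trans (by gcongr; exact Real.le_norm_self _)⟩
  have hB₁ : ∀ᵐ p ∂volume.restrict unitSq, ‖A₁ p‖ₑ ≤ B :=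
    hall.mono fun p h => enorm_le_coe.2 h.2.2.1
  have hB₂ : ∀ᵐ p ∂volume.restrict unitSq, ‖A₂ p‖ₑ ≤ B :=
    hall.mono fun p h => enorm_le_coe.2 h.2.2.2.1
  obtain ⟨S, hS, hdiff⟩ := exists_solutionOperator hf₁ hf₂
    (hreg.contDiff_f₁.mono fun _ h => h.differentiable one_ne_zero)
    (hreg.contDiff_f₂.mono fun _ h => h.differentiable one_ne_zero)
    hderiv.derivBounded.1 hderiv.derivBounded.2
    (enorm_multOp_le hreg.memLp_A₁.1 hB₁) (enorm_multOp_le hreg.memLp_A₂.1 hB₂)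
  have hsol : ∀ v z, IsSolution f₁ f₂ A₁ A₂ v z ↔ z = (AC02.mixedEquiv n).symm (S v) := by
    intro v z
    rw [isSolution_iff hf₁ hf₂ hreg.memLp_A₁.1 hreg.memLp_A₂.1 hB₁ hB₂, hS,
      ← AC02.mixedEquiv_apply, LinearIsometryEquiv.eq_symm_apply]
  have hD : Differentiable ℝ fun v => (AC02.mixedEquiv n).symm (S v) :=
    (AC02.mixedEquiv n).symm.differentiable.comp hdiff
  exact ⟨fun v => ⟨_, (hsol v _).2 rfl, fun z hz => (hsol v z).1 hz⟩,
    _, fun v => (hsol v _).2 rfl, hD.continuous, hD⟩
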